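/- All tree languages are sets of trees whose symbols come from a ranked set $\Gamma$ (each symbol $\sigma$ has a rank $\mathrm{rk}(\sigma)\in\{0,1,2,\dots\}$, and a node labelled $\sigma$ has exactly $\mathrm{rk}(\sigma)$ ordered children). A *$k$-ary pattern* is a tree with variables $x_1,\dots,x_k$ at leaves, each occurring exactly once. A *multiple context-free tree grammar* (MCFTG) consists of: a finite ranked set $N$ of nonterminals; a finite set $\mathcal N$ of big nonterminals, which are nonempty repetition-free sequences over $N$, distinct ones having distinct underlying sets; a finite terminal alphabet $\Sigma\subseteq\Gamma$, disjoint from $N$, with at least one symbol of rank $\ge 1$; an initial nonterminal $S\in\mathcal N$ of length $1$ and rank $0$; and a finite set of rules $(A_1,\dots,A_n)\to((u_1,\dots,u_n),\mathcal L)$, where $(A_1,\dots,A_n)\in\mathcal N$, each $u_j$ is an $\mathrm{rk}(A_j)$-ary pattern over $N\cup\Sigma$, no nonterminal occurs more than once in $(u_1,\dots,u_n)$, and $\mathcal L\subseteq\mathcal N$ is such that the underlying sets of its members partition the set of nonterminals occurring in $(u_1,\dots,u_n)$. The forest languages $L(G,A)$, $A\in\mathcal N$, are the smallest sets such that for each rule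 $A\to(u,\mathcal L)$ and each choice of forests $f(B)\in L(G,B)$ for $B\in\mathcal L$, the forest $u[f]$, obtained from $u$ by simultaneous second-order substitution of $f(B)$ for $B$ (for all $B\in\mathcal L$), is in $L(G,A)$. Put $L(G)=L(G,S)$, and let $\mathrm{MCFT}$ be the class of all these tree languages. A $k$-ary pattern is *footed* if $k=0$, or $k\ge1$ and it has a node (its foot node) with exactly $k$ children, which are $x_1,\dots,x_k$ in this order. An *MC-TAG* is an MCFTG in which every $u_j$ of every rule is footed and for which there is an equivalence relation $\equiv$ on $N\cup\Sigma$ such that (1) distinct equivalent terminals have different ranks; (2) every nonterminal is equivalent to some terminal; (3) for every rule as above and every $j$, the root label of $u_j$ is equivalent to $A_j$ and, if $\mathrm{rk}(A_j)\ge1$, the label of the foot node of $u_j$ is equivalent to $A_j$. Let $\mathrm{MC\text{-}TAL}$ be the class of tree languages generated by MC-TAGs. A tree language $L$ is *root consistent* if any two trees in $L$ whose root labels differ have root labels of different rank. **Corollary.** (1) $\mathrm{MC\text{-}TAL}=\{L\in\mathrm{MCFT}\mid L\text{ is root consistent}\}$. (2) Let $\#\in\Gamma$ be a symbol of rank $1$,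 and let $L$ be a tree language in whose trees $\#$ does not occur. Then $L\in\mathrm{MCFT}$ if and only if $\#(L)=\{\#(t)\mid t\in L\}\in\mathrm{MC\text{-}TAL}$. (3) $\mathrm{MC\text{-}TAL}$ is properly included in $\mathrm{MCFT}$, provided that $\Gamma$ has a symbol of rank $0$, a symbol of rank at least $1$, and two distinct symbols of the same rank. -/

import Mathlib

universe u v w

/-- Trees over the ranked set `(Γ, rk)` with variables in `V`; a node labelled `s` has exactly
`rk s` children.  Trees over `Fin k` use the variables `x₁, …, x_k`, the variable `x_{i+1}` being
`i : Fin k`.  Trees over `Fin 0` are the trees without variables. -/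
inductive RTree {Γ : Type u} (rk : Γ → ℕ) (V : Type v) : Type (max u v) where
  | var (x : V) : RTree rk V
  | node (s : Γ) (c : Fin (rk s) → RTree rk V) : RTree rk V

namespace RTree

variable {Γ : Type u} {rk : Γ → ℕ} {V : Type v} {W : Type w}

/-- The multiset of all occurrences of variables in a tree. -/
def vars : RTree rk V → Multiset V
  | var x => {x}
  | node _ c => ∑ i, (c i).vars

/-- The multiset of all occurrences of symbols (labels that are not variables) in a tree. -/
def symbols : RTree rk V → Multiset Γ
  | var _ => 0
  | node s c => s ::ₘ ∑ i, (c i).symbols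

/-- The label of the root, if it is not a variable. -/
def rootLabel : RTree rk V → Option Γ
  | var _ => none
  | node s _ => some s

/-- The subtree at a position, if the position exists.  The number `i` in a position selects
the child with index `i`, counted from `0`. -/
def subtreeAt : RTree rk V → List ℕ → Option (RTree rk V)
  | t, [] => some t
  | var _, _ :: _ => none
  | node s c, i :: p => if h : i < rk s then (c ⟨i, h⟩).subtreeAt p else none

/-- First-order substitution of trees for variables. -/
def subst (f : V → RTree rk W) : RTree rk V → RTree rk W
  | var x => f x
  | node s c => node s fun i => (c i).subst f

/-- The tree `s(x₁, …, x_k)`, where `k` is the rank of `s`. -/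
def init (s : Γ) : RTree rk (Fin (rk s)) := node s var

/-- The tree homomorphism determined by a rank-preserving map from symbols to trees. -/
def hom {Δ : Type w} {rk' : Δ → ℕ} (h : (s : Γ) → RTree rk' (Fin (rk s))) :
    RTree rk V → RTree rk' V
  | var x => var x
  | node s c => (h s).subst fun i => (c i).hom h

/-- A tree with variables among `x₁, …, x_k` is a pattern if each of these variables occurs in it
exactly once. -/
def IsPattern {k : ℕ} (t : RTree rk (Fin k)) : Prop :=
  t.vars.Nodup ∧ ∀ x, x ∈ t.vars

/-- `t` has a node with label `s` of rank `k` whose children are `x₁, …, x_k`, in this order.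
If `t` is a pattern and `k ≥ 1` then there is at most one such node, the foot node of `t`. -/
def HasFootLabel {k : ℕ} (t : RTree rk (Fin k)) (s : Γ) : Prop :=
  ∃ (p : List ℕ) (c : Fin (rk s) → RTree rk (Fin k)) (h : rk s = k),
    t.subtreeAt p = some (node s c) ∧ ∀ i, c i = var (Fin.cast h i)

/-- A footed pattern: its variables, if any, are, in order, the children of one node. -/
def IsFooted {k : ℕ} (t : RTree rk (Fin k)) : Prop :=
  k = 0 ∨ (1 ≤ k ∧ ∃ s, t.HasFootLabel s)

/-- A variable-free tree over `Γ`, viewed as a tree over `N ∪ Γ` (`N` and `Γ` disjoint). -/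
def embed {N : Type w} {rkN : N → ℕ} : RTree rk (Fin 0) → RTree (Sum.elim rkN rk) V
  | var x => x.elim0
  | node s c => node (rk := Sum.elim rkN rk) (Sum.inr s) fun i => (c i).embed

/-- The second-order substitution that replaces each symbol `C` of `N` by `f C` and leaves the
symbols of `Γ` unchanged. -/
def subst₂ {N : Type w} {rkN : N → ℕ} (f : (C : N) → RTree (Sum.elim rkN rk) (Fin (rkN C))) :
    RTree (Sum.elim rkN rk) V → RTree (Sum.elim rkN rk) V :=
  hom fun s => match s with
    | Sum.inl C => f C
    | Sum.inr a => init (rk := Sum.elim rkN rk) (Sum.inr a)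

/-- The tree `s(t)`, if the symbol `s` has rank 1. -/
def mark (s : Γ) (t : RTree rk V) : RTree rk V := node s fun _ => t

end RTree

/-- A forest over `N ∪ Γ` of the same length and with the same numbers of variables as the
sequence `A` of elements of `N`. -/
abbrev RForest {N : Type} {Γ : Type u} (rkN : N → ℕ) (rk : Γ → ℕ) (A : List N) : Type u :=
  (j : Fin A.length) → RTree (Sum.elim rkN rk) (Fin (rkN (A.get j)))

/-- The form of a rule `A → (u, ℒ)`. -/
structure MCFTRule {N : Type} {Γ : Type u} (rkN : N → ℕ) (rk : Γ → ℕ) where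
  lhs : List N
  rhs : RForest rkN rk lhs
  links : Set (List N)

/-- All occurrences of symbols in the right-hand side of a rule. -/
def MCFTRule.symbols {N : Type} {Γ : Type u} {rkN : N → ℕ} {rk : Γ → ℕ}
    (ρ : MCFTRule rkN rk) : Multiset (N ⊕ Γ) :=
  ∑ j, (ρ.rhs j).symbols

/-- Multiple context-free tree grammars with terminals from the ranked set `(Γ, rk)`.  The
terminal alphabet is a finite subset of `Γ`. -/
structure MCFTG {Γ : Type u} (rk : Γ → ℕ) where
  /-- nonterminals -/
  N : Type
  finite_N : Finite N
  rkN : N → ℕ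
  /-- big nonterminals -/
  big : Set (List N)
  finite_big : big.Finite
  big_ne_nil : ∀ A ∈ big, A ≠ []
  big_nodup : ∀ A ∈ big, A.Nodup
  big_inj : ∀ A ∈ big, ∀ A' ∈ big, (∀ C, C ∈ A ↔ C ∈ A') → A = A'
  /-- terminals -/
  terminals : Set Γ
  finite_terminals : terminals.Finite
  exists_terminal : ∃ s ∈ terminals, 1 ≤ rk s
  /-- initial nonterminal -/
  start : N
  start_mem : [start] ∈ big
  rk_start : rkN start = 0
  rules : Set (MCFTRule rkN rk)
  finite_rules : rules.Finite
  lhs_mem : ∀ ρ ∈ rules, ρ.lhs ∈ big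
  rhs_pattern : ∀ ρ ∈ rules, ∀ j, (ρ.rhs j).IsPattern
  rhs_terminals : ∀ ρ ∈ rules, ∀ s, Sum.inr s ∈ ρ.symbols → s ∈ terminals
  /-- no nonterminal occurs more than once in a right-hand side -/
  rhs_unique : ∀ ρ ∈ rules, (ρ.symbols.filterMap Sum.getLeft?).Nodup
  links_big : ∀ ρ ∈ rules, ρ.links ⊆ big
  /-- the links partition the set of nonterminals that occur in the right-hand side -/
  links_cover : ∀ ρ ∈ rules, ∀ C, Sum.inl C ∈ ρ.symbols ↔ ∃ B ∈ ρ.links, C ∈ B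
  links_disjoint : ∀ ρ ∈ rules, ∀ B ∈ ρ.links, ∀ B' ∈ ρ.links, B ≠ B' → List.Disjoint B B'

namespace MCFTG

variable {Γ : Type u} {rk : Γ → ℕ}

/-- `G.Gen A t`: the forest `t` is in the forest language generated by the big nonterminal `A`.
These languages are the smallest ones such that, for every rule `A → (u, ℒ)`, if for each
`B = (C₁, …, C_m)` in `ℒ` the forest `(f C₁, …, f C_m)` is in the language of `B`, then `u[f]`
is in the language of `A`.  (The big nonterminals in `ℒ` are repetition-free and disjoint, and
contain all nonterminals of `u`, so a choice of one forest for each of them is the same as a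
choice of one tree for each of their members; the other values of `f` do not matter.) -/
inductive Gen (G : MCFTG rk) : (A : List G.N) → RForest G.rkN rk A → Prop
  | rule (ρ : MCFTRule G.rkN rk) (hρ : ρ ∈ G.rules)
      (f : (C : G.N) → RTree (Sum.elim G.rkN rk) (Fin (G.rkN C)))
      (hf : ∀ B ∈ ρ.links, Gen G B fun j => f (B.get j)) :
      Gen G ρ.lhs fun j => (ρ.rhs j).subst₂ f

/-- The tree language generated by a grammar. -/
def language (G : MCFTG rk) : Set (RTree rk (Fin 0)) :=
  {t | G.Gen [G.start] fun _ => t.embed}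

/-- A grammar is footed if all trees in the right-hand sides of its rules are footed. -/
def IsFooted (G : MCFTG rk) : Prop :=
  ∀ ρ ∈ G.rules, ∀ j, (ρ.rhs j).IsFooted

/-- (Strict set-local) multi-component tree adjoining grammars.  Of the relation `r` only the
restriction to nonterminals and terminals of `G` matters. -/
def IsMCTAG (G : MCFTG rk) : Prop :=
  G.IsFooted ∧ ∃ r : Setoid (G.N ⊕ Γ),
    (∀ s ∈ G.terminals, ∀ t ∈ G.terminals,
      s ≠ t → r (Sum.inr s) (Sum.inr t) → rk s ≠ rk t) ∧
    (∀ C : G.N, ∃ s ∈ G.terminals, r (Sum.inl C) (Sum.inr s)) ∧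
    (∀ ρ ∈ G.rules, ∀ j : Fin ρ.lhs.length,
      (∃ a, (ρ.rhs j).rootLabel = some a ∧ r a (Sum.inl (ρ.lhs.get j))) ∧
      (1 ≤ G.rkN (ρ.lhs.get j) →
        ∀ a, (ρ.rhs j).HasFootLabel a → r a (Sum.inl (ρ.lhs.get j))))

end MCFTG

/-- The class of multiple context-free tree languages with symbols from `(Γ, rk)`. -/
def MCFT {Γ : Type u} (rk : Γ → ℕ) : Set (Set (RTree rk (Fin 0))) :=
  {L | ∃ G : MCFTG rk, G.language = L}

/-- The class of tree languages, with symbols from `(Γ, rk)`, generated by multi-component tree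
adjoining grammars. -/
def MCTAL {Γ : Type u} (rk : Γ → ℕ) : Set (Set (RTree rk (Fin 0))) :=
  {L | ∃ G : MCFTG rk, G.IsMCTAG ∧ G.language = L}

/-- Distinct root labels of trees in `L` have distinct ranks. -/
def RootConsistent {Γ : Type u} {rk : Γ → ℕ} (L : Set (RTree rk (Fin 0))) : Prop :=
  ∀ t₁ ∈ L, ∀ t₂ ∈ L, ∀ s₁ s₂, t₁.rootLabel = some s₁ → t₂.rootLabel = some s₂ →
    s₁ ≠ s₂ → rk s₁ ≠ rk s₂

/-! An MC-TAG generates a root consistent language because the relation `≡` is passed along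
derivations: the root label of a generated tree is equivalent to the nonterminal that generates it
(`Derives.exists_rootLabel`). Hence all root labels in the language are equivalent to the initial
nonterminal, and distinct ones have distinct ranks.

For the converse, every pattern generated by an arbitrary grammar is cut into pieces whose root
label and foot label coincide, and new nonterminals generate the pieces separately. What must be
bounded is the number of pieces. A piece with variables is named by the set `V` of variables below
it and by its label `σ`. If the name `(V, σ)` occurs twice along a path, then everything that
branches off between the two occurrences is closed, so the two pieces and all that lies between them
merge into one piece, which still has root and foot label `σ` (`exists_graft`,
`IsOpen.exists_split`). After merging, all names are distinct (`IsPattern.exists_decomposition`),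
and only finitely many shapes remain, a shape being a tree of distinct names.

A big nonterminal of the piece grammar is a big nonterminal `A` of the given grammar together with a
shape for each nonterminal; its components are the pieces that occur in the shapes of the members of
`A`. For a rule and shapes for its links, each nonterminal in the right-hand side is replaced by the
tree of its pieces, and the result is cut again, which yields the shapes of the left-hand side and
the right-hand sides for its pieces. Recomposing pieces and cutting forests are the two directions
of correctness (`pieceGrammar_sound`, `pieceGrammar_complete`).

A new initial nonterminal produces `w[B]`, where `B` is the single piece of the old one and `w` is a
fixed unary pattern. The equivalence identifies the new initial nonterminal and everything labelled
by a root label of some `w[t]`, and otherwise only symbols with the same label; this is where root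
consistency is needed (`isMCTAG_pieceGrammar`). With `w = x₁` this gives (1). With `w = #(x₁)`, root
consistency is automatic and one half of (2) follows; the other half erases `#` by a linear
nondeleting homomorphism (`language_map`). For (3), two trees with distinct root labels of equal
rank form a finite language that is not root consistent. -/

namespace RTree

/-! ### First-order substitution and the multisets of variables and symbols -/

section Algebra

variable {Γ : Type u} {rk : Γ → ℕ} {V : Type v} {W : Type w}

theorem subst_var (t : RTree rk V) : t.subst var = t := by
  induction t with
  | var x => rfl
  | node s c ih => simp only [subst, ih]

theorem subst_subst {X : Type*} (t : RTree rk V) (f : V → RTree rk W) (g : W → RTree rk X) :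
    (t.subst f).subst g = t.subst fun x => (f x).subst g := by
  induction t with
  | var x => rfl
  | node s c ih => simp only [subst, ih]

theorem subst_congr (t : RTree rk V) {f g : V → RTree rk W} (h : ∀ x ∈ t.vars, f x = g x) :
    t.subst f = t.subst g := by
  induction t with
  | var x => exact h x (by simp [vars])
  | node s c ih =>
    simp only [subst, node.injEq, heq_eq_eq, true_and]
    funext i
    refine ih i fun x hx => h x ?_
    simp only [vars, Multiset.mem_sum]
    exact ⟨i, Finset.mem_univ _, hx⟩

theorem mem_vars_node {s : Γ} {c : Fin (rk s) → RTree rk V} {x : V} :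
    x ∈ (node s c).vars ↔ ∃ i, x ∈ (c i).vars := by
  simp [vars, Multiset.mem_sum]

theorem mem_symbols_node {s a : Γ} {c : Fin (rk s) → RTree rk V} :
    a ∈ (node s c).symbols ↔ a = s ∨ ∃ i, a ∈ (c i).symbols := by
  simp [symbols, Multiset.mem_sum]

theorem _root_.Multiset.finset_sum_bind {ι α β : Type*} (S : Finset ι) (m : ι → Multiset α)
    (f : α → Multiset β) : (∑ i ∈ S, m i).bind f = ∑ i ∈ S, (m i).bind f := by
  classical
  induction S using Finset.induction_on with
  | empty => simp
  | insert a S ha ih => simp [Finset.sum_insert ha, Multiset.add_bind, ih]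

theorem vars_subst (t : RTree rk V) (f : V → RTree rk W) :
    (t.subst f).vars = t.vars.bind fun x => (f x).vars := by
  induction t with
  | var x => simp [subst, vars]
  | node s c ih => simp only [subst, vars, ih, Multiset.finset_sum_bind]

theorem symbols_subst (t : RTree rk V) (f : V → RTree rk W) :
    (t.subst f).symbols = t.symbols + t.vars.bind fun x => (f x).symbols := by
  induction t with
  | var x => simp [subst, vars, symbols]
  | node s c ih =>
    simp only [subst, vars, symbols, ih, Multiset.finset_sum_bind, Finset.sum_add_distrib,
      Multiset.cons_add]

theorem isPattern_iff {k : ℕ} {t : RTree rk (Fin k)} :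
    t.IsPattern ↔ t.vars = (Finset.univ : Finset (Fin k)).val := by
  constructor
  · rintro ⟨h₁, h₂⟩
    exact (Multiset.Nodup.ext h₁ Finset.univ.nodup).2 fun x => by simp [h₂ x]
  · intro h
    exact ⟨h ▸ Finset.univ.nodup, fun x => by simp [h]⟩

theorem vars_init (s : Γ) : (init (rk := rk) s).vars = (Finset.univ : Finset (Fin (rk s))).val := by
  simp only [init, vars]
  exact Finset.sum_multiset_singleton _

theorem isPattern_init (s : Γ) : (init (rk := rk) s).IsPattern :=
  isPattern_iff.2 (vars_init s)

theorem symbols_init (s : Γ) : (init (rk := rk) s).symbols = {s} := by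
  simp [init, symbols]

end Algebra

/-! ### Tree homomorphisms -/

section Hom

variable {Γ : Type u} {rk : Γ → ℕ} {V : Type v} {W : Type w}
variable {Δ : Type*} {rk' : Δ → ℕ}

theorem hom_init (t : RTree rk V) : t.hom (fun s => init (rk := rk) s) = t := by
  induction t with
  | var x => rfl
  | node s c ih =>
    simp only [hom, init, subst]
    exact congrArg _ (funext ih)

theorem init_hom (s : Γ) (h : (s : Γ) → RTree rk' (Fin (rk s))) :
    (init (rk := rk) s).hom h = h s := by
  simp only [init, hom, subst_var]

theorem hom_subst (t : RTree rk V) (f : V → RTree rk W)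
    (h : (s : Γ) → RTree rk' (Fin (rk s))) :
    (t.subst f).hom h = (t.hom h).subst fun x => (f x).hom h := by
  induction t with
  | var x => rfl
  | node s c ih => simp only [hom, subst, ih, subst_subst]

theorem hom_hom {Θ : Type*} {rk'' : Θ → ℕ} (t : RTree rk V)
    (h : (s : Γ) → RTree rk' (Fin (rk s))) (h' : (s : Δ) → RTree rk'' (Fin (rk' s))) :
    (t.hom h).hom h' = t.hom fun s => (h s).hom h' := by
  induction t with
  | var x => rfl
  | node s c ih => simp only [hom, hom_subst, ih]

theorem hom_congr (t : RTree rk V) {h h' : (s : Γ) → RTree rk' (Fin (rk s))}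
    (hh : ∀ s ∈ t.symbols, h s = h' s) : t.hom h = t.hom h' := by
  induction t with
  | var x => rfl
  | node s c ih =>
    simp only [hom]
    rw [hh s (mem_symbols_node.2 (Or.inl rfl))]
    congr 1
    funext i
    exact ih i fun a ha => hh a (mem_symbols_node.2 (Or.inr ⟨i, ha⟩))

/-- A pattern uses each of its variables exactly once, so substituting patterns neither copies nor
deletes subtrees. -/
theorem vars_hom (t : RTree rk V) (h : (s : Γ) → RTree rk' (Fin (rk s)))
    (hp : ∀ s ∈ t.symbols, (h s).IsPattern) : (t.hom h).vars = t.vars := by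
  induction t with
  | var x => rfl
  | node s c ih =>
    simp only [hom, vars_subst, vars]
    rw [isPattern_iff.1 (hp s (mem_symbols_node.2 (Or.inl rfl)))]
    exact Finset.sum_congr rfl fun i _ =>
      ih i fun a ha => hp a (mem_symbols_node.2 (Or.inr ⟨i, ha⟩))

theorem symbols_hom (t : RTree rk V) (h : (s : Γ) → RTree rk' (Fin (rk s)))
    (hp : ∀ s ∈ t.symbols, (h s).IsPattern) :
    (t.hom h).symbols = t.symbols.bind fun s => (h s).symbols := by
  induction t with
  | var x => rfl
  | node s c ih =>
    simp only [hom, symbols_subst, symbols, Multiset.cons_bind]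
    rw [isPattern_iff.1 (hp s (mem_symbols_node.2 (Or.inl rfl))), Multiset.finset_sum_bind]
    congr 1
    exact Finset.sum_congr rfl fun i _ =>
      ih i fun a ha => hp a (mem_symbols_node.2 (Or.inr ⟨i, ha⟩))

theorem IsPattern.hom {k : ℕ} {t : RTree rk (Fin k)} (ht : t.IsPattern)
    {h : (s : Γ) → RTree rk' (Fin (rk s))} (hp : ∀ s ∈ t.symbols, (h s).IsPattern) :
    (t.hom h).IsPattern := by
  rw [isPattern_iff, vars_hom t h hp, ← isPattern_iff]
  exact ht

theorem mem_symbols_hom {t : RTree rk V} {h : (s : Γ) → RTree rk' (Fin (rk s))} {b : Δ}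
    (hb : b ∈ (t.hom h).symbols) : ∃ s ∈ t.symbols, b ∈ (h s).symbols := by
  induction t with
  | var x => simp [RTree.hom, symbols] at hb
  | node s c ih =>
    simp only [RTree.hom, symbols_subst, Multiset.mem_add, Multiset.mem_bind] at hb
    rcases hb with hb | ⟨i, -, hb⟩
    · exact ⟨s, mem_symbols_node.2 (Or.inl rfl), hb⟩
    · obtain ⟨a, ha, hb⟩ := ih i hb
      exact ⟨a, mem_symbols_node.2 (Or.inr ⟨i, ha⟩), hb⟩

/-- By induction on the bound: the root uses up one symbol, so each of its finitely many children
obeys the smaller bound. It is what makes the set of shapes finite. -/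
theorem finite_setOf_card_symbols_le [Finite Γ] [Finite V] (m : ℕ) :
    {t : RTree rk V | t.symbols.card ≤ m}.Finite := by
  induction m with
  | zero =>
    refine (Set.finite_range (var : V → RTree rk V)).subset ?_
    rintro (x | ⟨s, c⟩) ht
    · exact ⟨x, rfl⟩
    · simp [symbols] at ht
  | succ m ih =>
    have hfin : (⋃ s : Γ, (fun c : Fin (rk s) → RTree rk V => node s c) ''
        (Set.univ.pi fun _ => {t : RTree rk V | t.symbols.card ≤ m})).Finite :=
      Set.finite_iUnion fun s => (Set.Finite.pi fun _ => ih).image _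
    refine ((Set.finite_range (var : V → RTree rk V)).union hfin).subset ?_
    rintro (x | ⟨s, c⟩) ht
    · exact Or.inl ⟨x, rfl⟩
    · refine Or.inr (Set.mem_iUnion.2 ⟨s, c, fun i _ => ?_, rfl⟩)
      simp only [Set.mem_ofPred_eq, symbols, Multiset.card_cons] at ht ⊢
      have h₁ : (c i).symbols ≤ ∑ i, (c i).symbols :=
        Finset.single_le_sum (f := fun i => (c i).symbols) (fun _ _ => Multiset.zero_le _)
          (Finset.mem_univ i)
      have := Multiset.card_le_card h₁
      omega

end Hom

/-! ### Foot nodes -/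

section Foot

variable {Γ : Type u} {rk : Γ → ℕ} {V : Type v} {k : ℕ}

theorem hasFootLabel_of_eq {s : Γ} {c : Fin (rk s) → RTree rk (Fin k)} (h : rk s = k)
    (hc : ∀ i, c i = var (Fin.cast h i)) : (node s c).HasFootLabel s :=
  ⟨[], c, h, rfl, hc⟩

theorem HasFootLabel.node {s a : Γ} {c : Fin (rk s) → RTree rk (Fin k)} {i : Fin (rk s)}
    (h : (c i).HasFootLabel a) : (node s c).HasFootLabel a := by
  obtain ⟨p, d, h, hp, hd⟩ := h
  refine ⟨i :: p, d, h, ?_, hd⟩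
  simp [subtreeAt, hp]

theorem not_hasFootLabel_var {x : Fin k} {a : Γ} : ¬ (var x : RTree rk (Fin k)).HasFootLabel a := by
  rintro ⟨p, d, h, hp, -⟩
  cases p <;> simp [subtreeAt] at hp

theorem HasFootLabel.cases {s a : Γ} {c : Fin (rk s) → RTree rk (Fin k)}
    (h : (RTree.node s c).HasFootLabel a) :
    (a = s ∧ ∃ h : rk s = k, ∀ i, c i = var (Fin.cast h i)) ∨ ∃ i, (c i).HasFootLabel a := by
  obtain ⟨p, d, h, hp, hd⟩ := h
  cases p with
  | nil =>
    simp only [subtreeAt, Option.some.injEq, RTree.node.injEq] at hp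
    obtain ⟨rfl, hcd⟩ := hp
    cases hcd
    exact Or.inl ⟨rfl, h, hd⟩
  | cons i p =>
    simp only [subtreeAt] at hp
    split_ifs at hp with hi
    exact Or.inr ⟨⟨i, hi⟩, p, d, h, hp, hd⟩

theorem HasFootLabel.mem_vars {a : Γ} {t : RTree rk (Fin k)} (h : t.HasFootLabel a) (x : Fin k) :
    x ∈ t.vars := by
  induction t with
  | var y => exact absurd h not_hasFootLabel_var
  | node s c ih =>
    rw [mem_vars_node]
    rcases h.cases with ⟨-, h, hc⟩ | ⟨i, hi⟩
    · exact ⟨Fin.cast h.symm x, by simp [hc, vars]⟩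
    · exact ⟨i, ih i hi⟩

theorem HasFootLabel.subst {a : Γ} {t : RTree rk V} {f : V → RTree rk (Fin k)} {x : V}
    (hx : x ∈ t.vars) (h : (f x).HasFootLabel a) : (t.subst f).HasFootLabel a := by
  induction t with
  | var y =>
    simp only [vars, Multiset.mem_singleton] at hx
    subst hx
    exact h
  | node s c ih =>
    obtain ⟨i, hi⟩ := mem_vars_node.1 hx
    exact HasFootLabel.node (c := fun i => (c i).subst f) (ih i hi)

/-- A variable below two different children would occur at least twice. This disjointness drives
both the uniqueness of foot nodes and the distinctness of the names of pieces. -/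
theorem eq_of_mem_vars_of_nodup {s : Γ} {c : Fin (rk s) → RTree rk V} (hn : (node s c).vars.Nodup)
    {i j : Fin (rk s)} {x : V} (hi : x ∈ (c i).vars) (hj : x ∈ (c j).vars) : i = j := by
  classical
  by_contra hij
  have hle : (c i).vars + (c j).vars ≤ (node s c).vars := by
    simp only [vars]
    rw [← Finset.sum_pair (f := fun i => (c i).vars) hij]
    exact Finset.sum_le_sum_of_subset (Finset.subset_univ _)
  exact Multiset.disjoint_left.1 (Multiset.nodup_add.1 (Multiset.nodup_of_le hle hn)).2.2 hi hj

theorem vars_child_le {s : Γ} (c : Fin (rk s) → RTree rk V) (i : Fin (rk s)) :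
    (c i).vars ≤ (node s c).vars :=
  Finset.single_le_sum (f := fun i => (c i).vars) (fun _ _ => Multiset.zero_le _)
    (Finset.mem_univ i)

theorem symbols_child_le {s : Γ} (c : Fin (rk s) → RTree rk V) (i : Fin (rk s)) :
    (c i).symbols ≤ (node s c).symbols :=
  (Finset.single_le_sum (f := fun i => (c i).symbols) (fun _ _ => Multiset.zero_le _)
    (Finset.mem_univ i)).trans (Multiset.le_cons_self _ _)

/-- Every foot node has the variable `x₁` below it, and `x₁` occurs only once, so at each level two
foot nodes lie below the same child. -/
theorem HasFootLabel.unique {a b : Γ} {t : RTree rk (Fin k)} (hk : 1 ≤ k) (hn : t.vars.Nodup)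
    (ha : t.HasFootLabel a) (hb : t.HasFootLabel b) : a = b := by
  induction t with
  | var y => exact absurd ha not_hasFootLabel_var
  | node s c ih =>
    rcases ha.cases with ⟨rfl, h, hc⟩ | ⟨i, hi⟩
    · rcases hb.cases with ⟨rfl, -, -⟩ | ⟨j, hj⟩
      · rfl
      · rw [hc j] at hj
        exact absurd hj not_hasFootLabel_var
    · rcases hb.cases with ⟨rfl, h, hc⟩ | ⟨j, hj⟩
      · rw [hc i] at hi
        exact absurd hi not_hasFootLabel_var
      · obtain rfl : i = j :=
          eq_of_mem_vars_of_nodup hn (hi.mem_vars ⟨0, hk⟩) (hj.mem_vars ⟨0, hk⟩)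
        exact ih i (Multiset.nodup_of_le (vars_child_le c i) hn) hi hj

end Foot

end RTree

/-! ### Terminal trees inside trees over nonterminals and terminals -/

namespace RTree

variable {Γ : Type u} {rk : Γ → ℕ} {V : Type v} {W : Type w} {N : Type} {rkN : N → ℕ}

/-- A tree over `Γ`, viewed as a tree over `N ∪ Γ`. -/
def lift (rkN : N → ℕ) : RTree rk V → RTree (Sum.elim rkN rk) V :=
  hom fun a => init (rk := Sum.elim rkN rk) (Sum.inr a)

/-- The second-order substitution of trees over `Γ` for the symbols of `N`. -/
def eval (f : (C : N) → RTree rk (Fin (rkN C))) : RTree (Sum.elim rkN rk) V → RTree rk V :=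
  hom fun s => match s with
    | Sum.inl C => f C
    | Sum.inr a => init a

/-- A variable-free tree, viewed as a tree with variables in `V`. -/
def weaken (t : RTree rk (Fin 0)) : RTree rk V := t.subst fun x => x.elim0

theorem weaken_self (t : RTree rk (Fin 0)) : t.weaken = t := by
  rw [weaken, ← subst_var t, subst_subst]
  exact subst_congr _ fun x => x.elim0

theorem subst_weaken (t : RTree rk (Fin 0)) (f : V → RTree rk W) :
    (t.weaken : RTree rk V).subst f = t.weaken := by
  rw [weaken, weaken, subst_subst]
  exact subst_congr _ fun x => x.elim0

theorem embed_eq (t : RTree rk (Fin 0)) :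
    (t.embed : RTree (Sum.elim rkN rk) V) = (t.weaken : RTree rk V).lift rkN := by
  induction t with
  | var x => exact x.elim0
  | node s c ih =>
    exact congrArg _ (funext ih)

/-- This allows derivations to be treated with trees over terminals only. -/
theorem subst₂_eq_lift_eval (f : (C : N) → RTree rk (Fin (rkN C)))
    (t : RTree (Sum.elim rkN rk) V) :
    t.subst₂ (fun C => (f C).lift rkN) = (t.eval f).lift rkN := by
  refine (hom_congr t fun s _ => ?_).trans (hom_hom t _ _).symm
  rcases s with C | a
  · rfl
  · exact (init_hom (rk := rk) a fun a => init (rk := Sum.elim rkN rk) (Sum.inr a)).symm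

theorem eval_lift (f : (C : N) → RTree rk (Fin (rkN C))) (t : RTree rk V) :
    (t.lift rkN).eval f = t := by
  refine (hom_hom t _ _).trans ((hom_congr t fun a _ => ?_).trans (hom_init t))
  exact init_hom (rk := Sum.elim rkN rk) (Sum.inr a) _

/-- `eval f` is a left inverse for any `f`. If no `f` exists, because some rank admits no tree at
all, a direct induction takes its place. -/
theorem lift_injective : Function.Injective (lift rkN : RTree rk V → _) := by
  intro t t' h
  by_cases hne : Nonempty ((C : N) → RTree rk (Fin (rkN C)))
  · obtain ⟨f⟩ := hne
    rw [← eval_lift f t, h, eval_lift]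
  · induction t generalizing t' with
    | var x =>
      cases t' with
      | var y => simpa [lift, hom] using h
      | node s c => simp [lift, hom, init, subst] at h
    | node s c ih =>
      cases t' with
      | var y => simp [lift, hom, init, subst] at h
      | node s' c' =>
        simp only [lift, hom, init, subst, node.injEq, Sum.inr.injEq] at h
        obtain ⟨rfl, h⟩ := h
        exact congrArg _ (funext fun i => ih i (congrFun (eq_of_heq h) i))

theorem subst₂_congr {f g : (C : N) → RTree (Sum.elim rkN rk) (Fin (rkN C))}
    {t : RTree (Sum.elim rkN rk) V} (h : ∀ C, Sum.inl C ∈ t.symbols → f C = g C) :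
    t.subst₂ f = t.subst₂ g := by
  refine hom_congr t fun s hs => ?_
  rcases s with C | a
  · exact h C hs
  · rfl

theorem eval_congr {f g : (C : N) → RTree rk (Fin (rkN C))}
    {t : RTree (Sum.elim rkN rk) V} (h : ∀ C, Sum.inl C ∈ t.symbols → f C = g C) :
    t.eval f = t.eval g := by
  refine hom_congr t fun s hs => ?_
  rcases s with C | a
  · exact h C hs
  · rfl

theorem eval_subst (f : (C : N) → RTree rk (Fin (rkN C))) (t : RTree (Sum.elim rkN rk) V)
    (g : V → RTree (Sum.elim rkN rk) W) :
    (t.subst g).eval f = (t.eval f).subst fun x => (g x).eval f :=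
  hom_subst t g _

theorem symbols_lift (t : RTree rk V) : (t.lift rkN).symbols = t.symbols.map Sum.inr := by
  induction t with
  | var x => rfl
  | node s c ih =>
    simp only [lift, hom, init, subst, symbols, Multiset.map_cons]
    congr 1
    rw [← Multiset.coe_mapAddMonoidHom, map_sum]
    exact Finset.sum_congr rfl fun i _ => ih i

theorem vars_lift (t : RTree rk V) : (t.lift rkN).vars = t.vars :=
  vars_hom t _ fun a _ => isPattern_init (rk := Sum.elim rkN rk) (Sum.inr a)

end RTree

/-- Big nonterminals are repetition-free, so data given for each component can be turned into a
dependent function on all nonterminals; this avoids casts between the ranks of components. -/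
theorem Function.Injective.exists_dep_extend {ι α : Type*} {P : α → Type*} {e : ι → α}
    (he : Function.Injective e) [∀ a, Nonempty (P a)] (F : ∀ i, P (e i)) :
    ∃ g : ∀ a, P a, ∀ i, g (e i) = F i := by
  classical
  refine ⟨fun a => if h : ∃ i, e i = a then h.choose_spec ▸ F h.choose else Classical.arbitrary _,
    fun i => ?_⟩
  have h : ∃ j, e j = e i := ⟨i, rfl⟩
  simp only [dif_pos h]
  have key : ∀ (j : ι) (hj : e j = e i), (hj ▸ F j : P (e i)) = F i := by
    intro j hj
    obtain rfl := he hj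
    rfl
  exact key _ h.choose_spec

/-! ### Derivations of terminal forests -/

namespace MCFTG

variable {Γ : Type u} {rk : Γ → ℕ}

/-- The forests over terminals that a big nonterminal generates, where the components of a
forest are given by a function on all nonterminals. -/
inductive Derives (G : MCFTG rk) : List G.N → ((C : G.N) → RTree rk (Fin (G.rkN C))) → Prop
  | rule (ρ : MCFTRule G.rkN rk) (hρ : ρ ∈ G.rules)
      (f : (C : G.N) → RTree rk (Fin (G.rkN C))) (hf : ∀ B ∈ ρ.links, Derives G B f)
      (g : (C : G.N) → RTree rk (Fin (G.rkN C)))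
      (hg : ∀ j, g (ρ.lhs.get j) = (ρ.rhs j).eval f) : Derives G ρ.lhs g

variable {G : MCFTG rk}

theorem Derives.congr {A : List G.N} {g g' : (C : G.N) → RTree rk (Fin (G.rkN C))}
    (h : G.Derives A g) (hg : ∀ C ∈ A, g C = g' C) : G.Derives A g' := by
  cases h with
  | rule ρ hρ f hf _ hgf =>
    exact .rule ρ hρ f hf _ fun j => by rw [← hg _ (List.get_mem _ _), hgf j]

theorem _root_.MCFTRule.mem_symbols {N : Type} {rkN : N → ℕ} {ρ : MCFTRule rkN rk} {s : N ⊕ Γ} :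
    s ∈ ρ.symbols ↔ ∃ j, s ∈ (ρ.rhs j).symbols := by
  simp [MCFTRule.symbols, Multiset.mem_sum]

theorem Derives.gen {A : List G.N} {g : (C : G.N) → RTree rk (Fin (G.rkN C))}
    (h : G.Derives A g) : G.Gen A fun j => (g (A.get j)).lift G.rkN := by
  induction h with
  | rule ρ hρ f hf g hg ih =>
    have := Gen.rule ρ hρ (fun C => (f C).lift G.rkN) ih
    simpa only [RTree.subst₂_eq_lift_eval, ← hg] using this

/-- Together with `Derives.gen`, this replaces `Gen` by a relation on terminal trees. Inhabitants of
each arity are needed as values at nonterminals that play no role. -/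
theorem exists_derives_of_gen [hne : ∀ k, Nonempty (RTree rk (Fin k))] {A : List G.N}
    {t : RForest G.rkN rk A} (h : G.Gen A t) :
    ∃ g, G.Derives A g ∧ ∀ j, t j = (g (A.get j)).lift G.rkN := by
  classical
  induction h with
  | rule ρ hρ f hf ih =>
    -- `f'` undoes `lift` wherever possible. By induction this covers all nonterminals in the links;
    -- elsewhere the value is irrelevant.
    have hex : ∃ f' : (C : G.N) → RTree rk (Fin (G.rkN C)),
        ∀ C, ∀ t, f C = RTree.lift G.rkN t → f' C = t := by
      refine ⟨fun C => if h : ∃ t, f C = RTree.lift G.rkN t then h.choose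
        else Classical.arbitrary _, fun C t ht => ?_⟩
      have h : ∃ t, f C = RTree.lift G.rkN t := ⟨t, ht⟩
      simp only [dif_pos h]
      exact RTree.lift_injective (h.choose_spec.symm.trans ht)
    obtain ⟨f', hf'⟩ := hex
    have hl : ∀ B ∈ ρ.links, ∀ C ∈ B, f C = (f' C).lift G.rkN := by
      intro B hB C hC
      obtain ⟨g, -, hg⟩ := ih B hB
      obtain ⟨j, rfl⟩ := List.get_of_mem hC
      rw [hf' _ _ (hg j)]
      exact hg j
    obtain ⟨g, hg⟩ := Function.Injective.exists_dep_extend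
      (P := fun C => RTree rk (Fin (G.rkN C)))
      (List.nodup_iff_injective_get.1 (G.big_nodup _ (G.lhs_mem ρ hρ)))
      fun j => (ρ.rhs j).eval f'
    refine ⟨g, .rule ρ hρ f' (fun B hB => ?_) g hg, fun j => ?_⟩
    · obtain ⟨g, hd, hg⟩ := ih B hB
      refine hd.congr fun C hC => ?_
      obtain ⟨j, rfl⟩ := List.get_of_mem hC
      exact (hf' _ _ (hg j)).symm
    · rw [hg, ← RTree.subst₂_eq_lift_eval]
      refine RTree.subst₂_congr fun C hC => ?_
      obtain ⟨B, hB, hCB⟩ := (G.links_cover ρ hρ C).1 (MCFTRule.mem_symbols.2 ⟨j, hC⟩)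
      exact hl B hB C hCB

theorem mem_language_iff [∀ k, Nonempty (RTree rk (Fin k))] {t : RTree rk (Fin 0)} :
    t ∈ G.language ↔ ∃ g, G.Derives [G.start] g ∧ g G.start = t.weaken := by
  constructor
  · intro h
    obtain ⟨g, hg, ht⟩ := exists_derives_of_gen (show G.Gen [G.start] _ from h)
    refine ⟨g, hg, RTree.lift_injective (rkN := G.rkN) ?_⟩
    rw [← RTree.embed_eq]
    exact (ht 0).symm
  · rintro ⟨g, hg, ht⟩
    have := hg.gen
    show G.Gen [G.start] fun _ => t.embed
    have hj : (fun j => (g ([G.start].get j)).lift G.rkN) = fun _ => t.embed := by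
      funext j
      obtain rfl : j = ⟨0, by simp⟩ := Subsingleton.elim (α := Fin 1) _ _
      exact (congrArg _ ht).trans (RTree.embed_eq t).symm
    rwa [hj] at this

end MCFTG

namespace RTree

/-! ### Cutting patterns into pieces with equal root and foot labels -/

section Graft

variable {Γ : Type u} {rk : Γ → ℕ} {k : ℕ}

theorem exists_weaken_of_vars_eq_zero {V : Type v} {t : RTree rk V} (h : t.vars = 0) :
    ∃ t' : RTree rk (Fin 0), t'.weaken = t := by
  induction t with
  | var x => simp [vars] at h
  | node s c ih =>
    have hc : ∀ i, (c i).vars = 0 := fun i => by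
      have := vars_child_le c i
      rw [h] at this
      exact Multiset.le_zero.1 this
    choose d hd using fun i => ih i (hc i)
    refine ⟨node s d, ?_⟩
    exact congrArg _ (funext hd)

theorem vars_weaken {V : Type v} (t : RTree rk (Fin 0)) : (t.weaken : RTree rk V).vars = 0 := by
  rw [weaken, vars_subst]
  refine Multiset.eq_zero_of_forall_notMem fun x hx => ?_
  obtain ⟨i, -, -⟩ := Multiset.mem_bind.1 hx
  exact i.elim0

theorem isPattern_closed (t : RTree rk (Fin 0)) : t.IsPattern := by
  refine ⟨?_, fun x => x.elim0⟩
  rw [Multiset.eq_zero_of_forall_notMem (s := t.vars) fun x => x.elim0]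
  exact Multiset.nodup_zero

theorem rootLabel_subst {V : Type v} {W : Type w} {t : RTree rk V} {a : Γ}
    (h : t.rootLabel = some a) (f : V → RTree rk W) : (t.subst f).rootLabel = some a := by
  cases t with
  | var x => simp [rootLabel] at h
  | node s c => exact h

/-- The merging step: if all arguments of `p` except the `i`-th are closed and the `i`-th begins
with the pattern `q`, then `p` and `q` fuse into one pattern, with the root of `p` and the foot of
`q`. -/
theorem exists_graft {m r : ℕ} {p : RTree rk (Fin m)} (hp : p.IsPattern)
    {e : Fin m → RTree rk (Fin k)} {i : Fin m} (he : ∀ j, j ≠ i → (e j).vars = 0)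
    {q : RTree rk (Fin r)} (hq : q.IsPattern) {d : Fin r → RTree rk (Fin k)}
    (hi : e i = q.subst d) :
    ∃ p' : RTree rk (Fin r), p'.IsPattern ∧ (∀ a, q.HasFootLabel a → p'.HasFootLabel a) ∧
      (∀ a, p.rootLabel = some a → p'.rootLabel = some a) ∧ p'.subst d = p.subst e := by
  choose c hc using fun j : {j // j ≠ i} => exists_weaken_of_vars_eq_zero (he j.1 j.2)
  -- Put `q` in place of the `i`-th variable of `p` and absorb the closed arguments at the others.
  let f : Fin m → RTree rk (Fin r) := fun j => if h : j = i then q else (c ⟨j, h⟩).weaken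
  have hfi : f i = q := by simp [f]
  have hfj : ∀ j (h : j ≠ i), f j = (c ⟨j, h⟩).weaken := fun j h => by simp [f, h]
  refine ⟨p.subst f, ?_, fun a ha => ?_, fun a ha => rootLabel_subst ha f, ?_⟩
  · rw [isPattern_iff, vars_subst, isPattern_iff.1 hp]
    change ∑ j, (f j).vars = _
    rw [Finset.sum_eq_single i, hfi, isPattern_iff.1 hq]
    · intro j _ hj
      rw [hfj j hj, vars_weaken]
    · simp
  · exact HasFootLabel.subst (hp.2 i) (hfi.symm ▸ ha)
  · rw [subst_subst]
    congr 1
    funext j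
    by_cases h : j = i
    · subst h
      rw [hfi, hi]
    · rw [hfj j h, subst_weaken, hc]

end Graft

/-- The names of the pieces into which a `k`-ary pattern is cut.  The name `inl (V, σ)` is for
the piece with root label and foot label `σ` above the variables in `V`; the name
`inr (p, τ)` is for a piece without variables, with root label `τ`, which is a child of the
piece named by `p`. -/
abbrev PieceName {E : Type} (rkE : E → ℕ) (k : ℕ) : Type :=
  (Finset (Fin k) × E) ⊕ (Option (Σ p : Finset (Fin k) × E, Fin (rkE p.2)) × E)

namespace PieceName

variable {E : Type} {rkE : E → ℕ} {k : ℕ}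

/-- The rank of a piece. -/
def rank : PieceName rkE k → ℕ := Sum.elim (fun p => rkE p.2) fun _ => 0

/-- The name of the next piece with variables. -/
def key : PieceName rkE k → Option (Finset (Fin k) × E) :=
  Sum.elim some fun p => p.1.map fun q => q.1

/-- The root label of a piece. -/
def label : PieceName rkE k → E := Sum.elim (fun p => p.2) fun p => p.2

end PieceName

section Decomposition

open PieceName

variable {Ω : Type u} {rkΩ : Ω → ℕ} {E : Type} {rkE : E → ℕ} {k : ℕ}

/-- The pattern `p` has root label `σ` and, unless `k = 0`, foot label `σ`. -/
def IsPiece (lab : Ω → E) {k : ℕ} (σ : E) (p : RTree rkΩ (Fin k)) : Prop :=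
  p.IsPattern ∧ (∃ a, p.rootLabel = some a ∧ lab a = σ) ∧
    (k = 0 ∨ ∃ a, p.HasFootLabel a ∧ lab a = σ)

/-- A piece together with its name. -/
abbrev NamedPiece (rkΩ : Ω → ℕ) (rkE : E → ℕ) (k : ℕ) : Type u :=
  Σ ν : PieceName rkE k, RTree rkΩ (Fin ν.rank)

/-- The number of variables of a named piece. -/
abbrev NamedPiece.rank (P : NamedPiece rkΩ rkE k) : ℕ := P.1.rank

/-- A tree composed of named pieces. -/
abbrev PieceTree (rkΩ : Ω → ℕ) (rkE : E → ℕ) (k : ℕ) : Type u :=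
  RTree (NamedPiece.rank (rkΩ := rkΩ) (rkE := rkE) (k := k)) (Fin k)

/-- The tree that is composed of the given pieces. -/
def PieceTree.expand (D : PieceTree rkΩ rkE k) : RTree rkΩ (Fin k) := D.hom fun P => P.2

/-- The names of the pieces. -/
def PieceTree.names (D : PieceTree rkΩ rkE k) : Multiset (PieceName rkE k) :=
  D.symbols.map fun P => P.1

/-- The tree that consists of one piece without variables. -/
def PieceTree.leaf (p : Option (Σ p : Finset (Fin k) × E, Fin (rkE p.2))) (τ : E)
    (t : RTree rkΩ (Fin 0)) : PieceTree rkΩ rkE k :=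
  node (rk := NamedPiece.rank (rkΩ := rkΩ) (rkE := rkE) (k := k)) ⟨Sum.inr (p, τ), t⟩
    fun i => i.elim0

/-- The tree with a piece with root and foot label `σ` on top. -/
def PieceTree.cons (V : Finset (Fin k)) (σ : E) (p : RTree rkΩ (Fin (rkE σ)))
    (c : Fin (rkE σ) → PieceTree rkΩ rkE k) : PieceTree rkΩ rkE k :=
  node (rk := NamedPiece.rank (rkΩ := rkΩ) (rkE := rkE) (k := k)) ⟨Sum.inl (V, σ), p⟩ c

namespace PieceTree

theorem names_cons (V : Finset (Fin k)) (σ : E) (p : RTree rkΩ (Fin (rkE σ)))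
    (c : Fin (rkE σ) → PieceTree rkΩ rkE k) :
    (cons V σ p c).names = Sum.inl (V, σ) ::ₘ ∑ i, (c i).names := by
  simp only [names, cons, symbols, Multiset.map_cons]
  congr 1
  rw [← Multiset.coe_mapAddMonoidHom, map_sum]
  rfl

theorem names_leaf (p : Option (Σ p : Finset (Fin k) × E, Fin (rkE p.2))) (τ : E)
    (t : RTree rkΩ (Fin 0)) : (leaf (rkΩ := rkΩ) p τ t).names = {Sum.inr (p, τ)} := by
  have : (∑ i : Fin 0, (symbols (i.elim0 : PieceTree rkΩ rkE k))) = 0 := rfl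
  simp only [names, leaf, symbols]
  exact congrArg (fun m => Multiset.map _ (_ ::ₘ m)) this

theorem expand_leaf (p : Option (Σ p : Finset (Fin k) × E, Fin (rkE p.2))) (τ : E)
    (t : RTree rkΩ (Fin 0)) : (leaf (rkΩ := rkΩ) p τ t).expand = t.weaken :=
  subst_congr t fun x => x.elim0

theorem names_child_le (V : Finset (Fin k)) (σ : E) (p : RTree rkΩ (Fin (rkE σ)))
    (c : Fin (rkE σ) → PieceTree rkΩ rkE k) (i : Fin (rkE σ)) :
    (c i).names ≤ (cons V σ p c).names :=
  Multiset.map_le_map (symbols_child_le (rk := NamedPiece.rank) (s := ⟨Sum.inl (V, σ), p⟩) c i)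

theorem mem_vars_cons {V : Finset (Fin k)} {σ : E} {p : RTree rkΩ (Fin (rkE σ))}
    {c : Fin (rkE σ) → PieceTree rkΩ rkE k} {x : Fin k} :
    x ∈ (cons V σ p c).vars ↔ ∃ i, x ∈ (c i).vars :=
  mem_vars_node

theorem vars_leaf (p : Option (Σ p : Finset (Fin k) × E, Fin (rkE p.2))) (τ : E)
    (t : RTree rkΩ (Fin 0)) : (leaf (rkΩ := rkΩ) p τ t).vars = 0 := rfl

/-- `D.IsOpen lab` if the pieces of `D` are properly named and without repetitions, and the
root of `D` is a variable or a piece with variables. -/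
inductive IsOpen (lab : Ω → E) : PieceTree rkΩ rkE k → Prop
  | var (x : Fin k) : IsOpen lab (var x)
  | piece {V : Finset (Fin k)} {σ : E} {p : RTree rkΩ (Fin (rkE σ))}
      {c : Fin (rkE σ) → PieceTree rkΩ rkE k} (hV : V.Nonempty)
      (hc : ∀ x, x ∈ V ↔ ∃ i, x ∈ (c i).vars) (hp : p.IsPattern)
      (hroot : ∃ a, p.rootLabel = some a ∧ lab a = σ) (hfoot : ∃ a, p.HasFootLabel a ∧ lab a = σ)
      (hn : (cons V σ p c).names.Nodup)
      (S : Set (Fin (rkE σ))) (hopen : ∀ i ∈ S, IsOpen lab (c i))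
      (hleaf : ∀ i ∉ S, ∃ (τ : E) (t : RTree rkΩ (Fin 0)),
        (∃ a, t.rootLabel = some a ∧ lab a = τ) ∧ c i = leaf (some ⟨(V, σ), i⟩) τ t) :
      IsOpen lab (cons V σ p c)

variable {lab : Ω → E} {D : PieceTree rkΩ rkE k}

theorem isPiece_of_mem_leaf {p : Option (Σ p : Finset (Fin k) × E, Fin (rkE p.2))} {τ : E}
    {t : RTree rkΩ (Fin 0)} (ht : ∃ a, t.rootLabel = some a ∧ lab a = τ) :
    ∀ P ∈ (leaf (rkΩ := rkΩ) p τ t).symbols, IsPiece lab P.1.label P.2 := by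
  intro P hP
  rcases mem_symbols_node.1 hP with rfl | ⟨i, hi⟩
  · exact ⟨isPattern_closed t, ht, Or.inl rfl⟩
  · exact i.elim0

theorem IsOpen.isPiece (h : IsOpen lab D) : ∀ P ∈ D.symbols, IsPiece lab P.1.label P.2 := by
  induction h with
  | var x => simp [symbols]
  | @piece V σ p c hV hc hp hroot hfoot hn S hopen hleaf ih =>
    intro P hP
    rcases mem_symbols_node.1 hP with rfl | ⟨i, hi⟩
    · exact ⟨hp, hroot, Or.inr hfoot⟩
    · by_cases hS : i ∈ S
      · exact ih i hS P hi
      · obtain ⟨τ, t, ht, h⟩ := hleaf i hS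
        rw [h] at hi
        exact isPiece_of_mem_leaf ht P hi

theorem IsOpen.vars_expand (h : IsOpen lab D) : D.expand.vars = D.vars :=
  vars_hom D _ fun P hP => (h.isPiece P hP).1

theorem IsOpen.nodup_names (h : IsOpen lab D) : D.names.Nodup := by
  cases h with
  | var x => exact Multiset.nodup_zero
  | piece _ _ _ _ _ hn => exact hn

theorem IsOpen.names_inl (h : IsOpen lab D) {V : Finset (Fin k)} {σ : E}
    (hV : Sum.inl (V, σ) ∈ D.names) : V.Nonempty ∧ ∀ x ∈ V, x ∈ D.vars := by
  induction h with
  | var x => simp [names, symbols] at hV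
  | @piece V' σ' p c hV' hc hp hroot hfoot hn S hopen hleaf ih =>
    rw [names_cons, Multiset.mem_cons, Multiset.mem_sum] at hV
    rcases hV with hV | ⟨i, -, hi⟩
    · simp only [Sum.inl.injEq, Prod.mk.injEq] at hV
      obtain ⟨rfl, rfl⟩ := hV
      exact ⟨hV', fun x hx => mem_vars_cons.2 ((hc x).1 hx)⟩
    · by_cases hS : i ∈ S
      · obtain ⟨h₁, h₂⟩ := ih i hS hi
        exact ⟨h₁, fun x hx => mem_vars_cons.2 ⟨i, h₂ x hx⟩⟩
      · obtain ⟨τ, t, ht, h⟩ := hleaf i hS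
        simp [h, names_leaf] at hi

theorem IsOpen.names_inr (h : IsOpen lab D)
    {q : Option (Σ p : Finset (Fin k) × E, Fin (rkE p.2))} {τ : E}
    (hq : Sum.inr (q, τ) ∈ D.names) : ∃ p, q = some p ∧ Sum.inl p.1 ∈ D.names := by
  induction h with
  | var x => simp [names, symbols] at hq
  | @piece V' σ' p c hV' hc hp hroot hfoot hn S hopen hleaf ih =>
    have hq' := hq
    rw [names_cons, Multiset.mem_cons, Multiset.mem_sum] at hq
    rcases hq with hq | ⟨i, -, hi⟩
    · simp at hq
    · by_cases hS : i ∈ S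
      · obtain ⟨p, rfl, h⟩ := ih i hS hi
        exact ⟨p, rfl, Multiset.mem_of_le (names_child_le _ _ _ c i) h⟩
      · obtain ⟨τ, t, ht, h⟩ := hleaf i hS
        simp only [h, names_leaf, Multiset.mem_singleton, Sum.inr.injEq, Prod.mk.injEq] at hi
        obtain ⟨rfl, rfl⟩ := hi
        exact ⟨_, rfl, by simp [names_cons]⟩

theorem _root_.Multiset.nodup_finset_sum {ι α : Type*} [Fintype ι] {m : ι → Multiset α}
    (h₁ : ∀ i, (m i).Nodup) (h₂ : ∀ i j a, a ∈ m i → a ∈ m j → i = j) : (∑ i, m i).Nodup := by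
  classical
  refine Multiset.nodup_iff_count_le_one.2 fun a => ?_
  rw [Multiset.count_sum']
  by_cases h : ∃ i, a ∈ m i
  · obtain ⟨i, hi⟩ := h
    rw [Finset.sum_eq_single i]
    · exact Multiset.nodup_iff_count_le_one.1 (h₁ i) a
    · exact fun j _ hj => Multiset.count_eq_zero.2 fun ha => hj (h₂ _ _ a ha hi)
    · simp
  · rw [Finset.sum_eq_zero fun i _ => Multiset.count_eq_zero.2 fun ha => h ⟨i, ha⟩]
    exact zero_le_one

/-- Descend to the piece named `(V, σ)`. All variables of `D` lie in `V`, hence below that piece, so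
whatever branches off on the way is closed and can be absorbed: the part of `D` down to the foot of
that piece is a single pattern `q`. -/
theorem IsOpen.exists_split (h : IsOpen lab D) (hD : D.vars.Nodup) {V : Finset (Fin k)} {σ : E}
    (hV : Sum.inl (V, σ) ∈ D.names) (hDV : ∀ x ∈ D.vars, x ∈ V) :
    ∃ (p : RTree rkΩ (Fin (rkE σ))) (d : Fin (rkE σ) → PieceTree rkΩ rkE k)
      (q : RTree rkΩ (Fin (rkE σ))),
      IsOpen lab (cons V σ p d) ∧ (cons V σ p d).names ≤ D.names ∧ q.IsPattern ∧
      (∃ a, q.HasFootLabel a ∧ lab a = σ) ∧ D.expand = q.subst fun i => (d i).expand := by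
  induction h with
  | var x => simp [names, symbols] at hV
  | @piece V' σ' p c hV' hc hp hroot hfoot hn S hopen hleaf ih =>
    have hV₀ := hV
    rw [names_cons, Multiset.mem_cons, Multiset.mem_sum] at hV
    rcases hV with hV | ⟨i, -, hi⟩
    · simp only [Sum.inl.injEq, Prod.mk.injEq] at hV
      obtain ⟨rfl, rfl⟩ := hV
      exact ⟨p, c, p, .piece hV' hc hp hroot hfoot hn S hopen hleaf, le_rfl, hp, hfoot, rfl⟩
    -- A leaf piece carries only a name of the form `inr`, so the child that contains the sought
    -- name is open.
    · have hS : i ∈ S := by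
        by_contra hS
        obtain ⟨τ, t, ht, h⟩ := hleaf i hS
        simp [h, names_leaf] at hi
      have hVi := ((hopen i hS).names_inl hi).2
      obtain ⟨p', d, q, h₁, h₂, h₃, h₄, h₅⟩ := ih i hS
        (Multiset.nodup_of_le
          (vars_child_le (rk := NamedPiece.rank) (s := ⟨Sum.inl (V', σ'), p⟩) c i) hD) hi
        fun x hx => hDV x (mem_vars_cons.2 ⟨i, hx⟩)
      have hz : ∀ j, j ≠ i → (c j).expand.vars = 0 := by
        intro j hj
        by_cases hjS : j ∈ S
        · rw [(hopen j hjS).vars_expand]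
          refine Multiset.eq_zero_of_forall_notMem fun x hx => hj ?_
          exact eq_of_mem_vars_of_nodup hD hx (hVi x (hDV x (mem_vars_cons.2 ⟨j, hx⟩)))
        · obtain ⟨τ, t, ht, h⟩ := hleaf j hjS
          rw [h, expand_leaf, vars_weaken]
      obtain ⟨q', hq₁, hq₂, -, hq₄⟩ := exists_graft hp (e := fun i => (c i).expand) hz h₃ h₅
      obtain ⟨a, ha, haσ⟩ := h₄
      exact ⟨p', d, q', h₁, h₂.trans (names_child_le _ _ _ c i), hq₁, ⟨a, hq₂ a ha, haσ⟩,
        hq₄.symm⟩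

/-- Bottom-up construction: the root symbol becomes a new piece on top of the decomposed children,
unless its name is already taken below, in which case it is merged with the piece of that name. The
alternative of rank 0 in `hlab` is for nonterminals that stand for closed pieces, whose label may
have positive rank. -/
theorem exists_isOpen {T : RTree rkΩ (Fin k)} (hT : T.vars.Nodup) (hT₀ : T.vars ≠ 0)
    (hlab : ∀ a ∈ T.symbols, rkΩ a = rkE (lab a) ∨ rkΩ a = 0) :
    ∃ D : PieceTree rkΩ rkE k, IsOpen lab D ∧ D.expand = T := by
  induction T with
  | var x => exact ⟨.var x, .var x, rfl⟩
  | node a c ih =>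
    obtain ⟨x₀, hx₀⟩ := Multiset.exists_mem_of_ne_zero hT₀
    have hr : rkΩ a = rkE (lab a) := by
      -- A variable occurs below the root, so the root symbol cannot have rank 0.
      refine (hlab a (mem_symbols_node.2 (Or.inl rfl))).resolve_right fun h => ?_
      obtain ⟨i, -⟩ := mem_vars_node.1 hx₀
      exact (Fin.cast h i).elim0
    generalize hσ : lab a = σ at hr
    set V : Finset (Fin k) := (node a c).vars.toFinset with hVdef
    let S : Set (Fin (rkE σ)) := {i | (c (Fin.cast hr.symm i)).vars ≠ 0}
    have hchild : ∀ i, ∃ D : PieceTree rkΩ rkE k, D.expand = c (Fin.cast hr.symm i) ∧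
        (∀ x, x ∈ D.vars ↔ x ∈ (c (Fin.cast hr.symm i)).vars) ∧
        (i ∈ S → IsOpen lab D) ∧ (i ∉ S → ∃ (τ : E) (t : RTree rkΩ (Fin 0)),
          (∃ a, t.rootLabel = some a ∧ lab a = τ) ∧ D = leaf (some ⟨(V, σ), i⟩) τ t) := by
      intro i
      by_cases hi : i ∈ S
      · obtain ⟨D, h₁, h₂⟩ := ih (Fin.cast hr.symm i)
          (Multiset.nodup_of_le (vars_child_le c _) hT) hi
          fun b hb => hlab b (mem_symbols_node.2 (Or.inr ⟨_, hb⟩))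
        exact ⟨D, h₂, fun x => by rw [← h₂, h₁.vars_expand], fun _ => h₁, fun h => absurd hi h⟩
      · have h₀ : (c (Fin.cast hr.symm i)).vars = 0 := not_not.1 hi
        obtain ⟨t, ht⟩ := exists_weaken_of_vars_eq_zero h₀
        cases t with
        | var x => exact x.elim0
        | node b d =>
          refine ⟨leaf (some ⟨(V, σ), i⟩) (lab b) (node b d), (expand_leaf _ _ _).trans ht, fun x => ?_,
            fun h => absurd h hi, fun _ => ⟨_, _, ⟨b, rfl, rfl⟩, rfl⟩⟩
          rw [h₀, vars_leaf]
    choose D hDexp hDvars hDopen hDleaf using hchild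
    have hV : V.Nonempty := ⟨x₀, Multiset.mem_toFinset.2 hx₀⟩
    have hmemV : ∀ x, x ∈ V ↔ ∃ i, x ∈ (D i).vars := by
      intro x
      rw [hVdef, Multiset.mem_toFinset, mem_vars_node]
      constructor
      · rintro ⟨i, hi⟩
        exact ⟨Fin.cast hr i, (hDvars _ x).2 hi⟩
      · rintro ⟨i, hi⟩
        exact ⟨_, (hDvars _ x).1 hi⟩
    let p₀ : RTree rkΩ (Fin (rkE σ)) := node a fun i => .var (Fin.cast hr i)
    have hp₀foot : p₀.HasFootLabel a := hasFootLabel_of_eq hr fun i => rfl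
    have hp₀ : p₀.IsPattern := by
      rw [isPattern_iff]
      have : p₀ = (init a).subst fun i => .var (Fin.cast hr i) := rfl
      rw [this, vars_subst, vars_init]
      change ∑ i, ({Fin.cast hr i} : Multiset _) = _
      rw [← Finset.sum_multiset_singleton]
      exact Fintype.sum_equiv (finCongr hr) _ _ fun i => rfl
    have hp₀exp : (p₀.subst fun i => (D i).expand) = node a c := by
      change node a _ = node a c
      congr 1
      funext i
      exact hDexp _
    have hDij : ∀ i j x, x ∈ (D i).vars → x ∈ (D j).vars → i = j := by
      intro i j x hi hj
      have := eq_of_mem_vars_of_nodup hT ((hDvars i x).1 hi) ((hDvars j x).1 hj)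
      exact Fin.cast_injective _ this
    -- If the name of the new piece already occurs in a child, then all variables of `V` lie below
    -- that child, and the root symbol, the path and the old piece fuse into one piece `q'`; its
    -- children are those of the old piece.
    by_cases hcase : ∃ i, Sum.inl (V, σ) ∈ (D i).names
    · obtain ⟨i, hi⟩ := hcase
      have hiS : i ∈ S := by
        by_contra hS
        obtain ⟨τ, t, -, h⟩ := hDleaf i hS
        simp [h, names_leaf] at hi
      have hVi := ((hDopen i hiS).names_inl hi).2
      obtain ⟨p, d, q, h₁, h₂, h₃, h₄, h₅⟩ := (hDopen i hiS).exists_split (by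
        rw [← (hDopen i hiS).vars_expand, hDexp]
        exact Multiset.nodup_of_le (vars_child_le c _) hT) hi fun x hx => (hmemV x).2 ⟨i, hx⟩
      obtain ⟨q', hq₁, hq₂, hq₃, hq₄⟩ := exists_graft hp₀ (e := fun i => (D i).expand) (i := i)
        (fun j hj => Multiset.eq_zero_of_forall_notMem fun x hx => hj (by
          rw [hDexp, ← hDvars] at hx
          exact hDij _ _ x hx (hVi x ((hmemV x).2 ⟨j, hx⟩)))) h₃ h₅
      refine ⟨cons V σ q' d, ?_, hq₄.trans hp₀exp⟩
      obtain ⟨b, hb, hbσ⟩ := h₄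
      generalize hP : cons V σ p d = P at h₁
      cases h₁ with
      | var x => simp [cons] at hP
      | @piece V' σ' p' d' hV' hc' hp' hroot' hfoot' hn' S' hopen' hleaf' =>
        simp only [cons] at hP
        obtain ⟨⟨⟨rfl, rfl⟩, rfl⟩, rfl⟩ := hP
        refine .piece hV hc' hq₁ ⟨a, hq₃ a rfl, hσ⟩ ⟨b, hq₂ b hb, hbσ⟩ ?_ S' hopen' hleaf'
        rwa [names_cons] at hn' ⊢
    · push Not at hcase
      -- Every name determines its child: a key with variables involves a nonempty set of variables
      -- occurring only in that child, and a new leaf carries the index of the child explicitly.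
      have hDnames : ∀ i, ∀ ν ∈ (D i).names,
          (∃ p, Sum.inl p ∈ (D i).names ∧ ν.key = some p) ∨
          ∃ τ, ν = Sum.inr (some ⟨(V, σ), i⟩, τ) := by
        intro i ν hν
        by_cases hS : i ∈ S
        · left
          rcases ν with p | ⟨q, τ⟩
          · exact ⟨p, hν, rfl⟩
          · obtain ⟨p, rfl, h⟩ := (hDopen i hS).names_inr hν
            exact ⟨p.1, h, rfl⟩
        · right
          obtain ⟨τ, t, -, h⟩ := hDleaf i hS
          rw [h, names_leaf, Multiset.mem_singleton] at hν
          exact ⟨τ, hν⟩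
      have hDinl : ∀ i V' σ', Sum.inl (V', σ') ∈ (D i).names → ∃ x ∈ V', x ∈ (D i).vars := by
        intro i V' σ' h
        by_cases hS : i ∈ S
        · obtain ⟨⟨x, hx⟩, h₂⟩ := (hDopen i hS).names_inl h
          exact ⟨x, hx, h₂ x hx⟩
        · obtain ⟨τ, t, -, h'⟩ := hDleaf i hS
          simp [h', names_leaf] at h
      have hDsub : ∀ i V' σ', Sum.inl (V', σ') ∈ (D i).names → ∀ x ∈ V', x ∈ (D i).vars := by
        intro i V' σ' h
        by_cases hS : i ∈ S
        · exact ((hDopen i hS).names_inl h).2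
        · obtain ⟨τ, t, -, h'⟩ := hDleaf i hS
          simp [h', names_leaf] at h
      have hkey : ∀ i j V' σ', Sum.inl (V', σ') ∈ (D i).names → Sum.inl (V', σ') ∈ (D j).names →
          i = j := by
        intro i j V' σ' hi hj
        obtain ⟨x, hx, hxi⟩ := hDinl i V' σ' hi
        exact hDij i j x hxi (hDsub j V' σ' hj x hx)
      refine ⟨cons V σ p₀ D, .piece hV hmemV hp₀ ⟨a, rfl, hσ⟩ ⟨a, hp₀foot, hσ⟩ ?_ S hDopen hDleaf,
        hp₀exp⟩
      rw [names_cons, Multiset.nodup_cons, Multiset.mem_sum]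
      refine ⟨fun ⟨i, _, hi⟩ => hcase i hi, Multiset.nodup_finset_sum (fun i => ?_) ?_⟩
      · by_cases hS : i ∈ S
        · exact (hDopen i hS).nodup_names
        · obtain ⟨τ, t, -, h⟩ := hDleaf i hS
          rw [h, names_leaf]
          exact Multiset.nodup_singleton _
      · intro i j ν hi hj
        rcases hDnames i ν hi with ⟨p₁, h₁, hν₁⟩ | ⟨τ₁, rfl⟩
        · rcases hDnames j ν hj with ⟨p₂, h₂, hν₂⟩ | ⟨τ₂, rfl⟩
          · obtain rfl : p₁ = p₂ := Option.some_injective _ (hν₁.symm.trans hν₂)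
            exact hkey i j _ _ h₁ h₂
          · obtain rfl : (V, σ) = p₁ := Option.some_injective _ hν₁
            exact absurd h₁ (hcase i)
        · rcases hDnames j _ hj with ⟨p₂, h₂, hν₂⟩ | ⟨τ₂, hν₂⟩
          · obtain rfl : (V, σ) = p₂ := Option.some_injective _ hν₂
            exact absurd h₂ (hcase j)
          · simp only [Sum.inr.injEq, Prod.mk.injEq, Option.some.injEq, Sigma.mk.injEq] at hν₂
            exact eq_of_heq hν₂.1.2

end PieceTree

/-- A pattern over an alphabet with labels in `E` can be cut into pieces with distinct names,
each of which has equal root and foot label. -/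
theorem IsPattern.exists_decomposition [∀ n, Nonempty (RTree rkΩ (Fin n))] {lab : Ω → E}
    {T : RTree rkΩ (Fin k)} (hT : T.IsPattern)
    (hlab : ∀ a ∈ T.symbols, rkΩ a = rkE (lab a) ∨ rkΩ a = 0) :
    ∃ (s : RTree (PieceName.rank (rkE := rkE) (k := k)) (Fin k))
      (pc : (ν : PieceName rkE k) → RTree rkΩ (Fin ν.rank)),
      s.symbols.Nodup ∧ s.IsPattern ∧ s.hom pc = T ∧
      (∀ ν ∈ s.symbols, IsPiece lab ν.label (pc ν)) ∧
      (k = 0 → ∃ τ, s = node (rk := PieceName.rank) (Sum.inr (none, τ)) fun i => i.elim0) := by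
  obtain ⟨D, hD₁, hD₂, hD₃, hD₄⟩ : ∃ D : PieceTree rkΩ rkE k, D.names.Nodup ∧ D.expand = T ∧
      (∀ P ∈ D.symbols, IsPiece lab P.1.label P.2) ∧
      (k = 0 → ∃ τ t, D = .leaf none τ t) := by
    by_cases h₀ : T.vars = 0
    · obtain ⟨t, ht⟩ := exists_weaken_of_vars_eq_zero h₀
      cases t with
      | var x => exact x.elim0
      | node b d =>
        refine ⟨.leaf none (lab b) (node b d), ?_, (PieceTree.expand_leaf _ _ _).trans ht,
          PieceTree.isPiece_of_mem_leaf ⟨b, rfl, rfl⟩, fun _ => ⟨_, _, rfl⟩⟩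
        rw [PieceTree.names_leaf]
        exact Multiset.nodup_singleton _
    · obtain ⟨D, h, hexp⟩ := PieceTree.exists_isOpen hT.1 h₀ hlab
      refine ⟨D, h.nodup_names, hexp, h.isPiece, ?_⟩
      rintro rfl
      exact absurd (Multiset.eq_zero_of_forall_notMem fun x => x.elim0) h₀
  -- The shape forgets the pieces and keeps their names. As the names are distinct, the pieces are
  -- recovered as a function `pc` of the names.
  let nm : (P : NamedPiece rkΩ rkE k) → RTree (PieceName.rank (rkE := rkE) (k := k))
    (Fin P.rank) := fun P => init P.1
  have hnm : ∀ P ∈ D.symbols, (nm P).IsPattern := fun P _ => isPattern_init P.1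
  have hsym : (D.hom nm).symbols = D.names := by
    rw [symbols_hom D nm hnm, PieceTree.names, ← Multiset.bind_singleton]
    exact Multiset.bind_congr fun P _ => symbols_init P.1
  have hvars := vars_hom D nm hnm
  obtain ⟨pc, hpc⟩ := Function.Injective.exists_dep_extend
    (P := fun ν : PieceName rkE k => RTree rkΩ (Fin ν.rank))
    (e := fun P : {P // P ∈ D.symbols} => P.1.1)
    (fun P Q h => Subtype.ext (Multiset.inj_on_of_nodup_map hD₁ P.1 P.2 Q.1 Q.2 h))
    (fun P => P.1.2)
  refine ⟨D.hom nm, pc, hsym ▸ hD₁, ?_, ?_, ?_, ?_⟩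
  · rw [isPattern_iff, hvars, ← vars_hom D (fun P => P.2) fun P hP => (hD₃ P hP).1,
      ← isPattern_iff]
    rw [← hD₂] at hT
    exact hT
  · rw [← hD₂, hom_hom]
    refine hom_congr D fun P hP => ?_
    exact (init_hom P.1 pc).trans (hpc ⟨P, hP⟩)
  · intro ν hν
    rw [hsym, PieceTree.names, Multiset.mem_map] at hν
    obtain ⟨P, hP, rfl⟩ := hν
    rw [show pc P.1 = P.2 from hpc ⟨P, hP⟩]
    exact hD₃ P hP
  · intro hk
    obtain ⟨τ, t, rfl⟩ := hD₄ hk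
    refine ⟨τ, ?_⟩
    change node _ _ = _
    congr 1
    funext i
    exact i.elim0

end Decomposition
end RTree

open RTree in
/-- The rule whose right-hand side has the component `U C` for each nonterminal `C` on the left. -/
def MCFTRule.ofFun {N : Type} {Γ : Type u} {rkN : N → ℕ} {rk : Γ → ℕ} (A : List N)
    (U : (C : N) → RTree (Sum.elim rkN rk) (Fin (rkN C))) (links : Set (List N)) :
    MCFTRule rkN rk :=
  ⟨A, fun j => U (A.get j), links⟩

theorem MCFTRule.symbols_ofFun {N : Type} {Γ : Type u} {rkN : N → ℕ} {rk : Γ → ℕ} (A : List N)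
    (U : (C : N) → RTree (Sum.elim rkN rk) (Fin (rkN C))) (links : Set (List N)) :
    (MCFTRule.ofFun A U links).symbols = (A.map fun C => (U C).symbols).sum :=
  Fin.sum_univ_fun_getElem A fun C => (U C).symbols

theorem MCFTRule.mem_symbols_ofFun {N : Type} {Γ : Type u} {rkN : N → ℕ} {rk : Γ → ℕ}
    {A : List N} {U : (C : N) → RTree (Sum.elim rkN rk) (Fin (rkN C))} {links : Set (List N)}
    {s : N ⊕ Γ} : s ∈ (MCFTRule.ofFun A U links).symbols ↔ ∃ C ∈ A, s ∈ (U C).symbols := by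
  rw [mem_symbols]
  constructor
  · rintro ⟨j, hj⟩
    exact ⟨_, List.get_mem A j, hj⟩
  · rintro ⟨C, hC, hs⟩
    obtain ⟨j, rfl⟩ := List.get_of_mem hC
    exact ⟨j, hs⟩

/-! ### Shapes and nonterminals for pieces -/

namespace MCFTG

open RTree

variable {Γ : Type u} {rk : Γ → ℕ}

/-- The ways to compose a `k`-ary pattern from pieces with distinct names. -/
abbrev Shape {E : Type} (rkE : E → ℕ) (k : ℕ) : Type :=
  {s : RTree (PieceName.rank (rkE := rkE) (k := k)) (Fin k) // s.symbols.Nodup}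

/-- A tree with distinct names has at most as many symbols as there are names. -/
instance {E : Type} [Finite E] (rkE : E → ℕ) (k : ℕ) : Finite (Shape rkE k) := by
  have := Fintype.ofFinite (PieceName rkE k)
  refine ((finite_setOf_card_symbols_le (rk := PieceName.rank (rkE := rkE) (k := k))
    (V := Fin k) (Fintype.card (PieceName rkE k))).subset fun s hs => ?_).to_subtype
  exact Finset.card_le_univ ⟨s.symbols, hs⟩

instance {E : Type} [Nonempty E] (rkE : E → ℕ) (k : ℕ) : Nonempty (Shape rkE k) := by
  rcases k with _ | k
  · refine ⟨⟨node (rk := PieceName.rank) (Sum.inr (none, Classical.arbitrary E))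
      fun i => i.elim0, ?_⟩⟩
    refine Multiset.nodup_cons.2 ⟨fun h => ?_, ?_⟩
    · obtain ⟨i, -⟩ := Multiset.mem_sum.1 h
      exact i.elim0
    · exact Multiset.nodup_zero
  · exact ⟨⟨var 0, Multiset.nodup_zero⟩⟩

section Pieces

variable (G : MCFTG rk) {E : Type} (e : E → Γ)

/-- The big nonterminals of `G`. -/
abbrev Big : Type := {A : List G.N // A ∈ G.big}

/-- A big nonterminal with a shape for each nonterminal. -/
abbrev ShapedBig : Type := G.Big × ((C : G.N) → Shape (fun i => rk (e i)) (G.rkN C))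

/-- The nonterminals that generate the pieces. -/
abbrev PieceNT : Type :=
  Σ _ : G.ShapedBig e, Σ C : G.N, PieceName (fun i => rk (e i)) (G.rkN C)

/-- The ranks of the new nonterminals. -/
def pieceRank : Option (G.PieceNT e) → ℕ
  | none => 0
  | some B => B.2.2.rank

variable {G e}

/-- The sequence of nonterminals for the pieces of a forest generated by a big nonterminal. -/
noncomputable def pieceList (X : G.ShapedBig e) : List (Option (G.PieceNT e)) :=
  X.1.1.flatMap fun C => (X.2 C).1.symbols.toList.map fun ν => some ⟨X, C, ν⟩

theorem mem_pieceList {X : G.ShapedBig e} {B : Option (G.PieceNT e)} :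
    B ∈ pieceList X ↔ ∃ C ∈ X.1.1, ∃ ν ∈ (X.2 C).1.symbols, B = some ⟨X, C, ν⟩ := by
  simp only [pieceList, List.mem_flatMap, List.mem_map, Multiset.mem_toList]
  exact exists_congr fun C => and_congr_right fun _ => exists_congr fun ν =>
    and_congr_right fun _ => eq_comm

theorem none_notMem_pieceList {X : G.ShapedBig e} : none ∉ pieceList X := by
  simp [mem_pieceList]

theorem nodup_pieceList (X : G.ShapedBig e) : (pieceList X).Nodup := by
  refine List.nodup_flatMap.2 ⟨fun C _ => ?_, ?_⟩
  · refine List.Nodup.map (fun ν ν' h => by simpa using h) ?_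
    rw [← Multiset.coe_nodup, Multiset.coe_toList]
    exact (X.2 C).2
  · refine (G.big_nodup _ X.1.2).imp fun {C C'} h => ?_
    intro B hB hB'
    simp only [List.mem_map] at hB hB'
    obtain ⟨ν, -, rfl⟩ := hB
    obtain ⟨ν', -, h'⟩ := hB'
    simp only [Option.some.injEq, Sigma.mk.injEq, heq_eq_eq, true_and] at h'
    exact h h'.1.symm

/-- Each new nonterminal records the whole of `X`, so the sequences for different `X` are disjoint.
Injectivity of big nonterminals and disjointness of links follow from this. -/
theorem pieceList_eq_of_mem {X Y : G.ShapedBig e} {B : Option (G.PieceNT e)}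
    (hX : B ∈ pieceList X) (hY : B ∈ pieceList Y) : X = Y := by
  obtain ⟨C, -, ν, -, rfl⟩ := mem_pieceList.1 hX
  obtain ⟨C', -, ν', -, h⟩ := mem_pieceList.1 hY
  simp only [Option.some.injEq, Sigma.mk.injEq] at h
  exact h.1

theorem pieceList_inj {X Y : G.ShapedBig e} (hX : pieceList X ≠ [])
    (h : ∀ B, B ∈ pieceList X ↔ B ∈ pieceList Y) : X = Y := by
  obtain ⟨B, hB⟩ := List.exists_mem_of_ne_nil _ hX
  exact pieceList_eq_of_mem hB ((h B).1 hB)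

/-- The tree that is composed of the nonterminals for the pieces. -/
def shapeTree (X : G.ShapedBig e) (C : G.N) :
    RTree (Sum.elim (G.pieceRank e) rk) (Fin (G.rkN C)) :=
  (X.2 C).1.hom fun ν => init (rk := Sum.elim (G.pieceRank e) rk) (Sum.inl (some ⟨X, C, ν⟩))

theorem symbols_shapeTree (X : G.ShapedBig e) (C : G.N) :
    (shapeTree X C).symbols = (X.2 C).1.symbols.map fun ν => Sum.inl (some ⟨X, C, ν⟩) := by
  rw [← Multiset.bind_singleton]
  exact (symbols_hom (X.2 C).1 _ fun ν _ =>
    isPattern_init (rk := Sum.elim (G.pieceRank e) rk) (Sum.inl (some ⟨X, C, ν⟩))).trans <|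
    Multiset.bind_congr fun ν _ =>
      symbols_init (rk := Sum.elim (G.pieceRank e) rk) (Sum.inl (some ⟨X, C, ν⟩))

theorem isPattern_shapeTree {X : G.ShapedBig e} {C : G.N} (h : (X.2 C).1.IsPattern) :
    (shapeTree X C).IsPattern :=
  h.hom fun ν _ => isPattern_init (rk := Sum.elim (G.pieceRank e) rk) (Sum.inl (some ⟨X, C, ν⟩))

theorem eval_shapeTree (X : G.ShapedBig e) (C : G.N)
    (f : (B : Option (G.PieceNT e)) → RTree rk (Fin (G.pieceRank e B))) :
    (shapeTree X C).eval f = (X.2 C).1.hom fun ν => f (some ⟨X, C, ν⟩) :=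
  (hom_hom _ _ _).trans <| hom_congr _ fun ν _ =>
    init_hom (rk := Sum.elim (G.pieceRank e) rk) (Sum.inl (some ⟨X, C, ν⟩)) _

variable (L : G.N → G.Big) (sh : (C : G.N) → Shape (fun i => rk (e i)) (G.rkN C))

/-- The substitution of pieces for nonterminals, where the nonterminal `C` belongs to the link
`L C`. -/
def refine {V : Type} :
    RTree (Sum.elim G.rkN rk) V → RTree (Sum.elim (G.pieceRank e) rk) V :=
  hom fun s => match s with
    | Sum.inl C => shapeTree (L C, sh) C
    | Sum.inr a => init (rk := Sum.elim (G.pieceRank e) rk) (Sum.inr a)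

/-- Evaluating the pieces in the refined tree is the same as first composing them to the forests of
the original nonterminals. -/
theorem eval_refine {V : Type} (t : RTree (Sum.elim G.rkN rk) V)
    (f : (B : Option (G.PieceNT e)) → RTree rk (Fin (G.pieceRank e B))) :
    (refine L sh t).eval f = t.eval fun C => (sh C).1.hom fun ν => f (some ⟨(L C, sh), C, ν⟩) := by
  refine (hom_hom t _ _).trans (hom_congr t fun s _ => ?_)
  rcases s with C | a
  · exact eval_shapeTree (L C, sh) C f
  · exact init_hom (rk := Sum.elim (G.pieceRank e) rk) (Sum.inr a) _

variable {L sh}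

theorem refine_hom_isPattern {V : Type} {t : RTree (Sum.elim G.rkN rk) V}
    (h : ∀ C, Sum.inl C ∈ t.symbols → (sh C).1.IsPattern) : ∀ s ∈ t.symbols,
    (match s with
      | Sum.inl C => shapeTree (L C, sh) C
      | Sum.inr a => init (rk := Sum.elim (G.pieceRank e) rk) (Sum.inr a) :
      RTree (Sum.elim (G.pieceRank e) rk) (Fin (Sum.elim G.rkN rk s))).IsPattern := by
  intro s hs
  rcases s with C | a
  · exact isPattern_shapeTree (X := (L C, sh)) (h C hs)
  · exact isPattern_init (rk := Sum.elim (G.pieceRank e) rk) (Sum.inr a)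

theorem isPattern_refine {k : ℕ} {t : RTree (Sum.elim G.rkN rk) (Fin k)} (ht : t.IsPattern)
    (h : ∀ C, Sum.inl C ∈ t.symbols → (sh C).1.IsPattern) : (refine L sh t).IsPattern :=
  ht.hom (refine_hom_isPattern h)

variable (L sh) in
/-- The symbols that are substituted for a symbol. -/
def refineSymbols : G.N ⊕ Γ → Multiset (Option (G.PieceNT e) ⊕ Γ)
  | Sum.inl C => (sh C).1.symbols.map fun ν => Sum.inl (some ⟨(L C, sh), C, ν⟩)
  | Sum.inr a => {Sum.inr a}

theorem symbols_refine {V : Type} {t : RTree (Sum.elim G.rkN rk) V}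
    (h : ∀ C, Sum.inl C ∈ t.symbols → (sh C).1.IsPattern) :
    (refine L sh t).symbols = t.symbols.bind (refineSymbols L sh) := by
  refine (symbols_hom t _ (refine_hom_isPattern h)).trans (Multiset.bind_congr fun s _ => ?_)
  rcases s with C | a
  · exact symbols_shapeTree _ _
  · exact symbols_init (rk := Sum.elim (G.pieceRank e) rk) (Sum.inr a)

theorem mem_symbols_refine {V : Type} {t : RTree (Sum.elim G.rkN rk) V}
    {s : Option (G.PieceNT e) ⊕ Γ} (hs : s ∈ (refine L sh t).symbols) :
    (∃ C, Sum.inl C ∈ t.symbols ∧ ∃ ν ∈ (sh C).1.symbols, s = Sum.inl (some ⟨(L C, sh), C, ν⟩)) ∨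
      ∃ a, Sum.inr a ∈ t.symbols ∧ s = Sum.inr a := by
  obtain ⟨b, hb, hs⟩ := mem_symbols_hom hs
  rcases b with C | a
  · left
    have hs : s ∈ (shapeTree (L C, sh) C).symbols := hs
    rw [symbols_shapeTree, Multiset.mem_map] at hs
    obtain ⟨ν, hν, rfl⟩ := hs
    exact ⟨C, hb, ν, hν, rfl⟩
  · right
    have hs : s ∈ (init (rk := Sum.elim (G.pieceRank e) rk) (Sum.inr a)).symbols := hs
    rw [symbols_init, Multiset.mem_singleton] at hs
    exact ⟨a, hb, hs⟩

/-- The label of a nonterminal or terminal is `σ`. -/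
def HasLabel (e : E → Γ) : Option (G.PieceNT e) ⊕ Γ → E → Prop
  | Sum.inl none, _ => False
  | Sum.inl (some B), σ => B.2.2.label = σ
  | Sum.inr a, σ => a = e σ

theorem _root_.RTree.mem_symbols_of_rootLabel {V : Type v} {Δ : Type*} {rkΔ : Δ → ℕ}
    {t : RTree rkΔ V} {a : Δ} (h : t.rootLabel = some a) : a ∈ t.symbols := by
  cases t with
  | var x => simp [rootLabel] at h
  | node s c =>
    obtain rfl : s = a := by simpa [rootLabel] using h
    exact mem_symbols_node.2 (Or.inl rfl)

theorem _root_.RTree.HasFootLabel.mem_symbols {k : ℕ} {Δ : Type*} {rkΔ : Δ → ℕ}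
    {t : RTree rkΔ (Fin k)} {a : Δ} (h : t.HasFootLabel a) : a ∈ t.symbols := by
  induction t with
  | var x => exact absurd h not_hasFootLabel_var
  | node s c ih =>
    rcases h.cases with ⟨rfl, -⟩ | ⟨i, hi⟩
    · exact mem_symbols_node.2 (Or.inl rfl)
    · exact mem_symbols_node.2 (Or.inr ⟨i, ih i hi⟩)

/-- The pattern `t`, after substitution of pieces for nonterminals, is cut into the pieces `P ν`
according to the shape `s`. -/
structure IsDecomposition (L : G.N → G.Big) (sh : (C : G.N) → Shape (fun i => rk (e i)) (G.rkN C))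
    {k : ℕ} (t : RTree (Sum.elim G.rkN rk) (Fin k)) (s : Shape (fun i => rk (e i)) k)
    (P : (ν : PieceName (fun i => rk (e i)) k) →
      RTree (Sum.elim (G.pieceRank e) rk) (Fin ν.rank)) : Prop where
  isPattern : s.1.IsPattern
  hom_eq : s.1.hom P = refine L sh t
  isPattern_piece : ∀ ν ∈ s.1.symbols, (P ν).IsPattern
  mem_symbols : ∀ ν ∈ s.1.symbols, ∀ b ∈ (P ν).symbols, b ∈ (refine L sh t).symbols
  rootLabel : ∀ ν ∈ s.1.symbols, ∃ b, (P ν).rootLabel = some b ∧ HasLabel e b ν.label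
  footLabel : ∀ ν ∈ s.1.symbols, ν.rank = 0 ∨
    ∃ b, (P ν).HasFootLabel b ∧ HasLabel e b ν.label
  eq_node : k = 0 →
    ∃ τ, s.1 = node (rk := PieceName.rank) (Sum.inr (none, τ)) fun i => i.elim0

/-- `IsPattern.exists_decomposition` applied to the refined right-hand side, where the nonterminal
for a piece is labelled by the label of the piece and a terminal by itself. -/
theorem exists_refine_decomposition [Nonempty E] [∀ n, Nonempty (RTree rk (Fin n))]
    (he : ∀ a ∈ G.terminals, ∃ σ, e σ = a) {k : ℕ}
    {t : RTree (Sum.elim G.rkN rk) (Fin k)} (ht : t.IsPattern)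
    (h : ∀ C, Sum.inl C ∈ t.symbols → (sh C).1.IsPattern)
    (hterm : ∀ a, Sum.inr a ∈ t.symbols → a ∈ G.terminals) :
    ∃ s P, IsDecomposition L sh t s P := by
  have : ∀ n, Nonempty (RTree (Sum.elim (G.pieceRank e) rk) (Fin n)) := fun n =>
    ⟨(Classical.arbitrary (RTree rk (Fin n))).lift _⟩
  have hex : ∃ lab : Option (G.PieceNT e) ⊕ Γ → E,
      ∀ b ∈ (refine L sh t).symbols, HasLabel e b (lab b) := by
    have (b : Option (G.PieceNT e) ⊕ Γ) : ∃ σ, b ∈ (refine L sh t).symbols → HasLabel e b σ := by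
      by_cases hb : b ∈ (refine L sh t).symbols
      · rcases mem_symbols_refine hb with ⟨C, hC, ν, hν, rfl⟩ | ⟨a, ha, rfl⟩
        · exact ⟨_, fun _ => rfl⟩
        · obtain ⟨σ, rfl⟩ := he a (hterm a ha)
          exact ⟨σ, fun _ => rfl⟩
      · exact ⟨Classical.arbitrary E, fun h => absurd h hb⟩
    choose lab hlab using this
    exact ⟨lab, hlab⟩
  obtain ⟨lab, hlab⟩ := hex
  -- A nonterminal for a piece with variables has the rank of its label; one for a closed piece has
  -- rank 0.
  obtain ⟨s, P, h₁, h₂, h₃, h₄, h₅⟩ := (isPattern_refine (L := L) ht h).exists_decomposition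
    (lab := lab) (rkE := fun i => rk (e i)) (fun b hb => by
      have := hlab b hb
      rcases b with (_ | B) | a
      · exact this.elim
      · obtain ⟨X, C, ν⟩ := B
        rcases ν with ⟨W, σ⟩ | q
        · left
          rw [← show σ = lab _ from this]
          rfl
        · exact Or.inr rfl
      · left
        exact congrArg rk (show a = e (lab _) from this))
  have hsub : ∀ ν ∈ s.symbols, ∀ b ∈ (P ν).symbols, b ∈ (refine L sh t).symbols := by
    intro ν hν b hb
    rw [← h₃, symbols_hom _ _ fun ν hν => (h₄ ν hν).1]
    exact Multiset.mem_bind.2 ⟨ν, hν, hb⟩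
  refine ⟨⟨s, h₁⟩, P, h₂, h₃, fun ν hν => (h₄ ν hν).1, hsub, fun ν hν => ?_, fun ν hν => ?_, h₅⟩
  · obtain ⟨b, hb, hbν⟩ := (h₄ ν hν).2.1
    exact ⟨b, hb, hbν ▸ hlab b (hsub ν hν b (mem_symbols_of_rootLabel hb))⟩
  · refine (h₄ ν hν).2.2.imp_right ?_
    rintro ⟨b, hb, hbν⟩
    exact ⟨b, hb, hbν ▸ hlab b (hsub ν hν b hb.mem_symbols)⟩

end Pieces

end MCFTG

/-! ### Rules for pieces -/

namespace MCFTG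

open RTree

variable {Γ : Type u} {rk : Γ → ℕ}

section PieceGrammar

variable (G : MCFTG rk) {E : Type} (e : E → Γ)

open Classical in
/-- The link of a rule to which a nonterminal belongs. -/
noncomputable def link (ρ : G.rules) (C : G.N) : G.Big :=
  if h : ∃ B ∈ ρ.1.links, C ∈ B then ⟨h.choose, G.links_big ρ.1 ρ.2 h.choose_spec.1⟩
  else ⟨[G.start], G.start_mem⟩

variable {G}

theorem link_eq {ρ : G.rules} {B : G.Big} (hB : B.1 ∈ ρ.1.links) {C : G.N} (hC : C ∈ B.1) :
    G.link ρ C = B := by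
  have h : ∃ B ∈ ρ.1.links, C ∈ B := ⟨B, hB, hC⟩
  refine Subtype.ext ?_
  simp only [link, dif_pos h]
  by_contra hne
  exact G.links_disjoint ρ.1 ρ.2 _ h.choose_spec.1 _ hB hne h.choose_spec.2 hC

theorem link_mem {ρ : G.rules} {C : G.N} (hC : Sum.inl C ∈ ρ.1.symbols) :
    (G.link ρ C).1 ∈ ρ.1.links ∧ C ∈ (G.link ρ C).1 := by
  obtain ⟨B, hB, hCB⟩ := (G.links_cover ρ.1 ρ.2 C).1 hC
  rw [link_eq (B := ⟨B, G.links_big ρ.1 ρ.2 hB⟩) hB hCB]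
  exact ⟨hB, hCB⟩

variable (G)

/-- A shape for each nonterminal. -/
abbrev Shaping : Type := (C : G.N) → Shape (fun i => rk (e i)) (G.rkN C)

/-- A choice of decompositions of the right-hand sides of the rules. -/
structure Decompositions where
  shape : G.rules → G.Shaping e → G.Shaping e
  piece : G.rules → G.Shaping e → (C : G.N) → (ν : PieceName (fun i => rk (e i)) (G.rkN C)) →
    RTree (Sum.elim (G.pieceRank e) rk) (Fin ν.rank)
  isDecomposition : ∀ (ρ : G.rules) (sh : G.Shaping e),
    (∀ C, Sum.inl C ∈ ρ.1.symbols → (sh C).1.IsPattern) → ∀ j,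
      IsDecomposition (G.link ρ) sh (ρ.1.rhs j) (shape ρ sh (ρ.1.lhs.get j))
        (piece ρ sh (ρ.1.lhs.get j))

/-- One decomposition is fixed for each rule and each choice of shapes, so that finitely many rules
suffice. If some shape is not a pattern, nothing is required and arbitrary values serve. -/
theorem nonempty_decompositions [Nonempty E] [∀ n, Nonempty (RTree rk (Fin n))]
    (he : ∀ a ∈ G.terminals, ∃ σ, e σ = a) : Nonempty (G.Decompositions e) := by
  have hne : ∀ n, Nonempty (RTree (Sum.elim (G.pieceRank e) rk) (Fin n)) := fun n =>
    ⟨(Classical.arbitrary (RTree rk (Fin n))).lift _⟩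
  have key (ρ : G.rules) (sh : G.Shaping e) : ∃ F : (C : G.N) →
      Shape (fun i => rk (e i)) (G.rkN C) × ((ν : PieceName (fun i => rk (e i)) (G.rkN C)) →
        RTree (Sum.elim (G.pieceRank e) rk) (Fin ν.rank)),
      (∀ C, Sum.inl C ∈ ρ.1.symbols → (sh C).1.IsPattern) → ∀ j,
        IsDecomposition (G.link ρ) sh (ρ.1.rhs j) (F (ρ.1.lhs.get j)).1
          (F (ρ.1.lhs.get j)).2 := by
    by_cases h : ∀ C, Sum.inl C ∈ ρ.1.symbols → (sh C).1.IsPattern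
    · choose s P hsP using fun j => exists_refine_decomposition (L := G.link ρ) (sh := sh) he
        (G.rhs_pattern ρ.1 ρ.2 j)
        (fun C hC => h C (MCFTRule.mem_symbols.2 ⟨j, hC⟩))
        (fun a ha => G.rhs_terminals ρ.1 ρ.2 a (MCFTRule.mem_symbols.2 ⟨j, ha⟩))
      obtain ⟨F, hF⟩ := Function.Injective.exists_dep_extend
        (P := fun C => Shape (fun i => rk (e i)) (G.rkN C) ×
          ((ν : PieceName (fun i => rk (e i)) (G.rkN C)) →
            RTree (Sum.elim (G.pieceRank e) rk) (Fin ν.rank)))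
        (List.nodup_iff_injective_get.1 (G.big_nodup _ (G.lhs_mem ρ.1 ρ.2)))
        fun j => (s j, P j)
      refine ⟨F, fun _ j => ?_⟩
      rw [hF]
      exact hsP j
    · exact ⟨fun C => ⟨Classical.arbitrary _, fun ν => Classical.arbitrary _⟩, fun h' => absurd h' h⟩
  choose F hF using key
  exact ⟨⟨fun ρ sh C => (F ρ sh C).1, fun ρ sh C => (F ρ sh C).2, hF⟩⟩

variable {G e}

/-- The right-hand sides of a rule for pieces. -/
def pieceRhs (P : (C : G.N) → (ν : PieceName (fun i => rk (e i)) (G.rkN C)) →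
    RTree (Sum.elim (G.pieceRank e) rk) (Fin ν.rank)) :
    (B : Option (G.PieceNT e)) → RTree (Sum.elim (G.pieceRank e) rk) (Fin (G.pieceRank e B))
  | none => init (rk := Sum.elim (G.pieceRank e) rk) (Sum.inl none)
  | some B => P B.2.1 B.2.2

/-- The links of a rule for pieces. -/
def pieceLinks (ρ : G.rules) (sh : G.Shaping e) : Set (List (Option (G.PieceNT e))) :=
  {B' | ∃ B : G.Big, B.1 ∈ ρ.1.links ∧ pieceList (e := e) (B, sh) ≠ [] ∧
    B' = pieceList (e := e) (B, sh)}

/-- The rule for pieces that results from the rule `ρ` if the forests for the links have the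
shapes `sh`. -/
noncomputable def Decompositions.rule (D : G.Decompositions e) (ρ : G.rules) (sh : G.Shaping e)
    (X : G.ShapedBig e) : MCFTRule (G.pieceRank e) rk :=
  .ofFun (pieceList X) (pieceRhs (D.piece ρ sh)) (pieceLinks ρ sh)

/-- The condition under which `D.rule ρ sh X` is a rule.  Links without pieces are omitted from
the rule, but have to generate a forest. -/
structure Decompositions.IsRule (D : G.Decompositions e) (ρ : G.rules) (sh : G.Shaping e)
    (X : G.ShapedBig e) : Prop where
  lhs_eq : X.1.1 = ρ.1.lhs
  shape_eq : ∀ C ∈ ρ.1.lhs, X.2 C = D.shape ρ sh C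
  ne_nil : pieceList X ≠ []
  isPattern : ∀ C, Sum.inl C ∈ ρ.1.symbols → (sh C).1.IsPattern
  derives : ∀ B : G.Big, B.1 ∈ ρ.1.links → pieceList (e := e) (B, sh) = [] →
    ∀ pc : (C : G.N) → (ν : PieceName (fun i => rk (e i)) (G.rkN C)) → RTree rk (Fin ν.rank),
      G.Derives B.1 fun C => (sh C).1.hom (pc C)

/-- The right-hand side of a rule for the initial nonterminal. -/
def startTree (w : RTree rk (Fin 1)) (X : G.ShapedBig e) (τ : E) :
    RTree (Sum.elim (G.pieceRank e) rk) (Fin 0) :=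
  (w.lift (G.pieceRank e)).subst fun _ =>
    node (rk := Sum.elim (G.pieceRank e) rk) (Sum.inl (some ⟨X, G.start, Sum.inr (none, τ)⟩))
      fun i => i.elim0

/-- A rule for the initial nonterminal. -/
noncomputable def startRule (w : RTree rk (Fin 1)) (X : G.ShapedBig e) (τ : E) :
    MCFTRule (G.pieceRank e) rk :=
  .ofFun [none] (fun _ => (startTree w X τ).weaken) {pieceList X}

/-- The condition under which `startRule w X τ` is a rule. -/
structure IsStartRule (X : G.ShapedBig e) (τ : E) : Prop where
  lhs_eq : X.1.1 = [G.start]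
  shape_eq : (X.2 G.start).1 =
    node (rk := PieceName.rank) (Sum.inr (none, τ)) fun i => i.elim0
  rootLabel : ∃ t ∈ G.language, t.rootLabel = some (e τ)

theorem IsStartRule.pieceList_eq {X : G.ShapedBig e} {τ : E} (h : IsStartRule X τ) :
    pieceList X = [some ⟨X, G.start, Sum.inr (none, τ)⟩] := by
  have hs : (X.2 G.start).1.symbols = {Sum.inr (none, τ)} := by
    rw [h.shape_eq]
    have : (∑ i : Fin 0, symbols (i.elim0 : RTree
      (PieceName.rank (rkE := fun i => rk (e i)) (k := G.rkN G.start)) (Fin (G.rkN G.start)))) = 0 := rfl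
    exact congrArg (fun m => _ ::ₘ m) this
  rw [pieceList, h.lhs_eq, List.flatMap_singleton, hs, Multiset.toList_singleton,
    List.map_singleton]

variable {D : G.Decompositions e} {ρ : G.rules} {sh : G.Shaping e} {X : G.ShapedBig e}

theorem Decompositions.IsRule.isDecomposition (h : D.IsRule ρ sh X) {C : G.N} (hC : C ∈ ρ.1.lhs) :
    ∃ j, C = ρ.1.lhs.get j ∧
      IsDecomposition (G.link ρ) sh (ρ.1.rhs j) (X.2 (ρ.1.lhs.get j))
        (D.piece ρ sh (ρ.1.lhs.get j)) := by
  obtain ⟨j, rfl⟩ := List.get_of_mem hC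
  refine ⟨j, rfl, ?_⟩
  rw [h.shape_eq _ hC]
  exact D.isDecomposition ρ sh h.isPattern j

/-- Cutting only distributes the symbols of the refined right-hand sides over the pieces. The
conditions on occurrences and links of the new rule are thus inherited from the old one. -/
theorem Decompositions.IsRule.symbols_rule (h : D.IsRule ρ sh X) :
    (D.rule ρ sh X).symbols = ρ.1.symbols.bind (refineSymbols (G.link ρ) sh) := by
  rw [Decompositions.rule, MCFTRule.symbols_ofFun, pieceList, List.map_flatMap, List.flatMap_def,
    List.sum_flatten, h.lhs_eq, List.map_map, MCFTRule.symbols, Multiset.finset_sum_bind,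
    ← Fin.sum_univ_fun_getElem]
  refine Finset.sum_congr rfl fun j _ => ?_
  have hd := D.isDecomposition ρ sh h.isPattern j
  rw [← h.shape_eq _ (List.get_mem _ j)] at hd
  rw [← symbols_refine fun C hC => h.isPattern C (MCFTRule.mem_symbols.2 ⟨j, hC⟩), ← hd.hom_eq,
    symbols_hom _ _ hd.isPattern_piece, Function.comp_apply, List.map_map]
  conv_rhs => rw [← Multiset.coe_toList (X.2 (ρ.1.lhs.get j)).1.symbols]
  rw [Multiset.bind, Multiset.join, Multiset.map_coe, Multiset.sum_coe]
  rfl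

theorem left_bind_refine (L : G.N → G.Big) (m : Multiset (G.N ⊕ Γ)) :
    Multiset.filterMap Sum.getLeft? (m.bind (refineSymbols L sh)) =
    (m.filterMap Sum.getLeft?).bind fun C =>
      (sh C).1.symbols.map fun ν => some ⟨(L C, sh), C, ν⟩ := by
  rw [Multiset.filterMap_bind, Multiset.bind_filterMap]
  refine Multiset.bind_congr fun s _ => ?_
  rcases s with C | a
  · simp only [refineSymbols, Sum.getLeft?_inl, Multiset.filterMap_map]
    exact congrFun (Multiset.filterMap_eq_map
      fun ν => some (⟨(L C, sh), C, ν⟩ : G.PieceNT e)) _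
  · rfl

theorem Decompositions.IsRule.nodup (h : D.IsRule ρ sh X) :
    ((D.rule ρ sh X).symbols.filterMap Sum.getLeft?).Nodup := by
  rw [h.symbols_rule, left_bind_refine]
  have hn : (ρ.1.symbols.filterMap Sum.getLeft?).Nodup := G.rhs_unique ρ.1 ρ.2
  refine Multiset.nodup_bind.2 ⟨fun C _ => ?_, ?_⟩
  · exact (Multiset.nodup_map_iff_of_injective (fun ν ν' h => by simpa using h)).2 (sh C).2
  · refine Multiset.Nodup.pairwise (fun C _ C' _ hne => ?_) hn
    refine Multiset.disjoint_left.2 fun {B} hB hB' => hne ?_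
    obtain ⟨ν, -, rfl⟩ := Multiset.mem_map.1 hB
    obtain ⟨ν', -, h'⟩ := Multiset.mem_map.1 hB'
    exact (congrArg (fun B : G.PieceNT e => B.2.1) (Option.some_injective _ h')).symm

theorem Decompositions.IsRule.mem_symbols_rule (h : D.IsRule ρ sh X) {s} :
    s ∈ (D.rule ρ sh X).symbols ↔
      (∃ C, Sum.inl C ∈ ρ.1.symbols ∧ ∃ ν ∈ (sh C).1.symbols,
        s = Sum.inl (some ⟨(G.link ρ C, sh), C, ν⟩)) ∨
      ∃ a, Sum.inr a ∈ ρ.1.symbols ∧ s = Sum.inr a := by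
  rw [h.symbols_rule, Multiset.mem_bind]
  constructor
  · rintro ⟨C | a, hb, hs⟩
    · obtain ⟨ν, hν, rfl⟩ := Multiset.mem_map.1 hs
      exact Or.inl ⟨C, hb, ν, hν, rfl⟩
    · exact Or.inr ⟨a, hb, Multiset.mem_singleton.1 hs⟩
  · rintro (⟨C, hb, ν, hν, rfl⟩ | ⟨a, hb, rfl⟩)
    · exact ⟨_, hb, Multiset.mem_map.2 ⟨ν, hν, rfl⟩⟩
    · exact ⟨_, hb, Multiset.mem_singleton_self _⟩

theorem symbols_startTree {w : RTree rk (Fin 1)} (hw : w.IsPattern) (X : G.ShapedBig e) (τ : E) :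
    (startTree w X τ).symbols = w.symbols.map Sum.inr +
      {Sum.inl (some ⟨X, G.start, Sum.inr (none, τ)⟩)} := by
  rw [startTree, symbols_subst, symbols_lift, vars_lift, isPattern_iff.1 hw]
  congr 1

theorem symbols_startRule {w : RTree rk (Fin 1)} (hw : w.IsPattern) (X : G.ShapedBig e) (τ : E) :
    (startRule w X τ).symbols = w.symbols.map Sum.inr +
      {Sum.inl (some ⟨X, G.start, Sum.inr (none, τ)⟩)} := by
  rw [startRule, MCFTRule.symbols_ofFun, ← symbols_startTree hw]
  simp only [List.map_cons, List.map_nil, List.sum_cons, List.sum_nil, add_zero]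
  exact congrArg _ (weaken_self (startTree w X τ))

/-- Labels are meant to be the actual root labels of the generated trees; this propagates that
property through a rule. -/
theorem rootLabel_eval {V : Type} {b : Option (G.PieceNT e) ⊕ Γ} {σ : E}
    {t : RTree (Sum.elim (G.pieceRank e) rk) V} (ht : t.rootLabel = some b) (hb : HasLabel e b σ)
    {f : (B : Option (G.PieceNT e)) → RTree rk (Fin (G.pieceRank e B))}
    (hf : ∀ B : G.PieceNT e, b = Sum.inl (some B) → (f (some B)).rootLabel = some (e B.2.2.label)) :
    (t.eval f).rootLabel = some (e σ) := by
  cases t with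
  | var x => simp [rootLabel] at ht
  | node s c =>
    obtain rfl : s = b := by simpa [rootLabel] using ht
    rcases s with (_ | B) | a
    · exact hb.elim
    · rw [← show B.2.2.label = σ from hb]
      exact rootLabel_subst (hf B rfl) _
    · obtain rfl : a = e σ := hb
      rfl

end PieceGrammar

end MCFTG

/-! ### The piece grammar and its correctness -/

namespace MCFTG

open RTree

variable {Γ : Type u} {rk : Γ → ℕ}

section PieceGrammar

variable {G : MCFTG rk} {E : Type} {e : E → Γ}

/-- The grammar that generates the trees `w[t]`, with `t` in the language of `G`, from pieces with
equal root and foot labels. -/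
noncomputable def pieceGrammar [Finite E] (D : G.Decompositions e) (w : RTree rk (Fin 1))
    (hw : w.IsPattern) : MCFTG rk where
  N := Option (G.PieceNT e)
  finite_N := by
    have := G.finite_N
    have : Finite G.Big := G.finite_big.to_subtype
    infer_instance
  rkN := G.pieceRank e
  big := {B | B = [none] ∨ ∃ X : G.ShapedBig e, pieceList X ≠ [] ∧ B = pieceList X}
  finite_big := by
    have := G.finite_N
    have : Finite G.Big := G.finite_big.to_subtype
    refine ((Set.finite_singleton [none]).union
      (Set.finite_range (pieceList (G := G) (e := e)))).subset ?_
    rintro B (rfl | ⟨X, -, rfl⟩)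
    · exact Or.inl rfl
    · exact Or.inr ⟨X, rfl⟩
  big_ne_nil := by
    rintro B (rfl | ⟨X, hX, rfl⟩)
    · simp
    · exact hX
  big_nodup := by
    rintro B (rfl | ⟨X, hX, rfl⟩)
    · simp
    · exact nodup_pieceList X
  big_inj := by
    rintro B (rfl | ⟨X, hX, rfl⟩) B' (rfl | ⟨Y, hY, rfl⟩) h
    · rfl
    · exact absurd ((h none).1 (by simp)) none_notMem_pieceList
    · exact absurd ((h none).2 (by simp)) none_notMem_pieceList
    · rw [pieceList_inj hX h]
  terminals := G.terminals ∪ {a | a ∈ w.symbols}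
  finite_terminals := by
    classical
    refine G.finite_terminals.union ((w.symbols.toFinset.finite_toSet).subset fun a ha => ?_)
    simpa using ha
  exists_terminal := by
    obtain ⟨s, hs, h⟩ := G.exists_terminal
    exact ⟨s, Or.inl hs, h⟩
  start := none
  start_mem := Or.inl rfl
  rk_start := rfl
  rules := {r | (∃ ρ sh X, D.IsRule ρ sh X ∧ r = D.rule ρ sh X) ∨
    ∃ X τ, IsStartRule X τ ∧ r = startRule w X τ}
  finite_rules := by
    have := G.finite_N
    have : Finite G.Big := G.finite_big.to_subtype
    have : Finite G.rules := G.finite_rules.to_subtype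
    refine ((Set.finite_range fun p : G.rules × G.Shaping e × G.ShapedBig e =>
      D.rule p.1 p.2.1 p.2.2).union (Set.finite_range fun p : G.ShapedBig e × E =>
        startRule w p.1 p.2)).subset ?_
    rintro r (⟨ρ, sh, X, -, rfl⟩ | ⟨X, τ, -, rfl⟩)
    · exact Or.inl ⟨(ρ, sh, X), rfl⟩
    · exact Or.inr ⟨(X, τ), rfl⟩
  lhs_mem := by
    rintro r (⟨ρ, sh, X, h, rfl⟩ | ⟨X, τ, h, rfl⟩)
    · exact Or.inr ⟨X, h.ne_nil, rfl⟩
    · exact Or.inl rfl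
  rhs_pattern := by
    rintro r (⟨ρ, sh, X, h, rfl⟩ | ⟨X, τ, h, rfl⟩) j
    · obtain ⟨C, hC, ν, hν, hj⟩ := mem_pieceList.1 (List.get_mem (pieceList X) j)
      change (pieceRhs (D.piece ρ sh) ((pieceList X).get j)).IsPattern
      rw [hj]
      obtain ⟨j', rfl, hd⟩ := h.isDecomposition (h.lhs_eq ▸ hC)
      exact hd.isPattern_piece ν hν
    · change (RTree.weaken (V := Fin (G.pieceRank e ([none].get j))) (startTree w X τ)).IsPattern
      rw [List.mem_singleton.1 (List.get_mem [none] j)]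
      exact isPattern_closed _
  rhs_terminals := by
    rintro r (⟨ρ, sh, X, h, rfl⟩ | ⟨X, τ, h, rfl⟩) s hs
    · rw [h.mem_symbols_rule] at hs
      rcases hs with ⟨C, -, ν, -, h'⟩ | ⟨a, ha, h'⟩
      · simp at h'
      · obtain rfl := Sum.inr_injective h'
        exact Or.inl (G.rhs_terminals ρ.1 ρ.2 _ ha)
    · rw [symbols_startRule hw] at hs
      exact Or.inr (by simpa using hs)
  rhs_unique := by
    rintro r (⟨ρ, sh, X, h, rfl⟩ | ⟨X, τ, h, rfl⟩)
    · exact h.nodup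
    · rw [symbols_startRule hw, Multiset.filterMap_add, Multiset.filterMap_map]
      have : (w.symbols.filterMap (Sum.getLeft? ∘ Sum.inr) : Multiset (Option (G.PieceNT e))) = 0 :=
        Multiset.eq_zero_of_forall_notMem fun x hx => by simp [Multiset.mem_filterMap] at hx
      rw [this, zero_add]
      exact Multiset.nodup_singleton _
  links_big := by
    rintro r (⟨ρ, sh, X, h, rfl⟩ | ⟨X, τ, h, rfl⟩) B hB
    · obtain ⟨B', -, h, rfl⟩ := hB
      exact Or.inr ⟨_, h, rfl⟩
    · obtain rfl := Set.mem_singleton_iff.1 hB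
      exact Or.inr ⟨X, by simp [h.pieceList_eq], rfl⟩
  links_cover := by
    rintro r (⟨ρ, sh, X, h, rfl⟩ | ⟨X, τ, h, rfl⟩) B
    · rw [h.mem_symbols_rule]
      constructor
      · rintro (⟨C, hC, ν, hν, h'⟩ | ⟨a, -, h'⟩)
        · obtain rfl := Sum.inl_injective h'
          have hmem : some ⟨(G.link ρ C, sh), C, ν⟩ ∈ pieceList (e := e) (G.link ρ C, sh) :=
            mem_pieceList.2 ⟨C, (link_mem hC).2, ν, hν, rfl⟩
          exact ⟨_, ⟨_, (link_mem hC).1, List.ne_nil_of_mem hmem, rfl⟩, hmem⟩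
        · simp at h'
      · rintro ⟨_, ⟨A, hA, -, rfl⟩, hB⟩
        obtain ⟨C, hC, ν, hν, rfl⟩ := mem_pieceList.1 hB
        refine Or.inl ⟨C, (G.links_cover ρ.1 ρ.2 C).2 ⟨A.1, hA, hC⟩, ν, hν, ?_⟩
        rw [link_eq hA hC]
    · rw [symbols_startRule hw]
      simp [startRule, MCFTRule.ofFun, h.pieceList_eq]
  links_disjoint := by
    rintro r (⟨ρ, sh, X, h, rfl⟩ | ⟨X, τ, h, rfl⟩) B hB B' hB' hne
    · obtain ⟨A, -, -, rfl⟩ := hB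
      obtain ⟨A', -, -, rfl⟩ := hB'
      intro x hx hx'
      exact hne (by rw [pieceList_eq_of_mem hx hx'])
    · exact absurd ((Set.mem_singleton_iff.1 hB).trans (Set.mem_singleton_iff.1 hB').symm) hne

variable [Finite E] {D : G.Decompositions e} {w : RTree rk (Fin 1)} {hw : w.IsPattern}

/-- Induction on the derivation: the pieces are composed again according to the shapes, and
`eval_refine` turns the refined rule back into the original one. -/
theorem pieceGrammar_sound {A : List (pieceGrammar D w hw).N}
    {g : (B : (pieceGrammar D w hw).N) → RTree rk (Fin ((pieceGrammar D w hw).rkN B))}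
    (h : (pieceGrammar D w hw).Derives A g) : ∀ X : G.ShapedBig e, A = pieceList X →
      G.Derives X.1.1 fun C => (X.2 C).1.hom fun ν => g (some ⟨X, C, ν⟩) := by
  induction h with
  | rule r hr f hf g hg ih =>
    intro Y hY
    rcases hr with ⟨ρ, sh, X, h, rfl⟩ | ⟨X, τ, h, rfl⟩
    · obtain rfl : X = Y := pieceList_inj h.ne_nil fun B => by
        rw [← hY]
        rfl
      have hg' : ∀ B ∈ pieceList X, g B = (pieceRhs (D.piece ρ sh) B).eval f := by
        intro B hB
        obtain ⟨i, rfl⟩ := List.get_of_mem hB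
        exact hg i
      rw [h.lhs_eq]
      refine .rule ρ.1 ρ.2 (fun C => (sh C).1.hom fun ν => f (some ⟨(G.link ρ C, sh), C, ν⟩))
        (fun B hB => ?_) _ fun j => ?_
      · have hB' : B ∈ G.big := G.links_big ρ.1 ρ.2 hB
        have hcongr : ∀ C ∈ B, ((sh C).1.hom fun ν => f (some ⟨(⟨B, hB'⟩, sh), C, ν⟩)) =
            (sh C).1.hom fun ν => f (some ⟨(G.link ρ C, sh), C, ν⟩) := fun C hC => by
          rw [link_eq (B := ⟨B, hB'⟩) hB hC]
        -- A link without pieces is absent from the new rule; its derivation in `G` comes from the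
        -- side condition of the rule.
        by_cases hnil : pieceList (e := e) (⟨B, hB'⟩, sh) = []
        · exact (h.derives ⟨B, hB'⟩ hB hnil fun C ν => f (some ⟨(⟨B, hB'⟩, sh), C, ν⟩)).congr
            hcongr
        · exact (ih _ ⟨⟨B, hB'⟩, hB, hnil, rfl⟩ (⟨B, hB'⟩, sh) rfl).congr hcongr
      · have hd := D.isDecomposition ρ sh h.isPattern j
        have hmem := List.get_mem ρ.1.lhs j
        rw [← h.shape_eq _ hmem] at hd
        refine Eq.trans ?_ (eval_refine (G.link ρ) sh (ρ.1.rhs j) f)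
        rw [← hd.hom_eq]
        refine Eq.trans (hom_congr _ fun ν hν => ?_) (hom_hom _ _ _).symm
        exact hg' _ (mem_pieceList.2 ⟨_, by rwa [h.lhs_eq], ν, hν, rfl⟩)
    · have : none ∈ pieceList Y := hY ▸ List.mem_singleton_self _
      exact absurd this none_notMem_pieceList

/-- The conclusion holds for every `X` that has the right shapes on `A`, whatever its other shapes
are, because a rule combines the shapes found for its several links into one shaping. The
information on root labels and on nonterminals of rank 0 is kept for the initial rule. -/
theorem pieceGrammar_complete {A : List G.N} [∀ n, Nonempty (RTree rk (Fin n))] [Nonempty E]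
    {g : (C : G.N) → RTree rk (Fin (G.rkN C))} (h : G.Derives A g) :
    ∃ (sh : G.Shaping e)
      (pc : (C : G.N) → (ν : PieceName (fun i => rk (e i)) (G.rkN C)) → RTree rk (Fin ν.rank)),
      (∀ C ∈ A, (sh C).1.IsPattern ∧ g C = (sh C).1.hom (pc C) ∧
        (∀ ν ∈ (sh C).1.symbols, (pc C ν).rootLabel = some (e ν.label)) ∧
        (G.rkN C = 0 → ∃ τ, (sh C).1 =
          node (rk := PieceName.rank) (Sum.inr (none, τ)) fun i => i.elim0)) ∧
      ∀ X : G.ShapedBig e, X.1.1 = A → (∀ C ∈ A, X.2 C = sh C) → pieceList X ≠ [] →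
        ∀ g' : (B : Option (G.PieceNT e)) → RTree rk (Fin (G.pieceRank e B)),
          (∀ C ∈ A, ∀ ν, g' (some ⟨X, C, ν⟩) = pc C ν) → (pieceGrammar D w hw).Derives (pieceList X) g' := by
  induction h with
  | rule r hr f hf g hg ih =>
    let ρ : G.rules := ⟨r, hr⟩
    choose sh pc hpc hder using ih
    classical
    -- The shapes and pieces obtained for the individual links are glued together; the links are
    -- disjoint, so there is no conflict.
    let sh' : G.Shaping e := fun C =>
      if h : (G.link ρ C).1 ∈ r.links then sh _ h C else Classical.arbitrary _
    let pc' : (C : G.N) → (ν : PieceName (fun i => rk (e i)) (G.rkN C)) → RTree rk (Fin ν.rank) :=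
      fun C => if h : (G.link ρ C).1 ∈ r.links then pc _ h C else fun _ => Classical.arbitrary _
    have hlink : ∀ (B : G.Big) (hB : B.1 ∈ r.links), ∀ C ∈ B.1,
        sh' C = sh B.1 hB C ∧ pc' C = pc B.1 hB C := by
      intro B hB C hC
      have := link_eq (ρ := ρ) hB hC
      have h' : (G.link ρ C).1 ∈ r.links := this ▸ hB
      simp only [sh', pc', dif_pos h']
      subst this
      exact ⟨rfl, rfl⟩
    have hpc' : ∀ C, Sum.inl C ∈ r.symbols → (sh' C).1.IsPattern ∧
        f C = (sh' C).1.hom (pc' C) ∧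
        (∀ ν ∈ (sh' C).1.symbols, (pc' C ν).rootLabel = some (e ν.label)) := by
      intro C hC
      obtain ⟨h₁, h₂⟩ := link_mem (ρ := ρ) hC
      obtain ⟨h₃, h₄⟩ := hlink _ h₁ C h₂
      rw [h₃, h₄]
      obtain ⟨h₅, h₆, h₇, -⟩ := hpc _ h₁ C h₂
      exact ⟨h₅, h₆, h₇⟩
    let f' : (B : Option (G.PieceNT e)) → RTree rk (Fin (G.pieceRank e B)) := fun B => match B with
      | none => Classical.arbitrary _
      | some B => pc' B.2.1 B.2.2
    have hdec : ∀ C ∈ r.lhs, ∃ j, C = r.lhs.get j ∧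
        IsDecomposition (G.link ρ) sh' (r.rhs j) (D.shape ρ sh' (r.lhs.get j))
          (D.piece ρ sh' (r.lhs.get j)) := by
      intro C hC
      obtain ⟨j, rfl⟩ := List.get_of_mem hC
      exact ⟨j, rfl, D.isDecomposition ρ sh' (fun C hC => (hpc' C hC).1) j⟩
    refine ⟨D.shape ρ sh', fun C ν => (D.piece ρ sh' C ν).eval f', ?_, ?_⟩
    · intro C hC
      obtain ⟨j, rfl, hd⟩ := hdec C hC
      refine ⟨hd.isPattern, ?_, fun ν hν => ?_, hd.eq_node⟩
      · rw [hg j]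
        refine Eq.trans ?_ (hom_hom _ (D.piece ρ sh' (r.lhs.get j)) _)
        rw [hd.hom_eq]
        refine Eq.trans ?_ (eval_refine _ _ _ _).symm
        exact eval_congr fun C hC => (hpc' C (MCFTRule.mem_symbols.2 ⟨j, hC⟩)).2.1
      · obtain ⟨b, hb, hbν⟩ := hd.rootLabel ν hν
        refine rootLabel_eval hb hbν fun B hB => ?_
        subst hB
        rcases mem_symbols_refine (hd.mem_symbols ν hν _ (mem_symbols_of_rootLabel hb)) with
          ⟨C, hC, ν', hν', h'⟩ | ⟨a, -, h'⟩
        · obtain rfl := Option.some_injective _ (Sum.inl_injective h')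
          exact (hpc' C (MCFTRule.mem_symbols.2 ⟨j, hC⟩)).2.2 ν' hν'
        · simp at h'
    · intro X hX hXsh hnil g' hg'
      have hrule : D.IsRule ρ sh' X := by
        -- For a link without pieces the shapes contain no names, so the composed forest does not
        -- depend on `pc''`.
        refine ⟨hX, hXsh, hnil, fun C hC => (hpc' C hC).1, fun B hB hB' pc'' => ?_⟩
        refine (hf B.1 hB).congr fun C hC => ?_
        obtain ⟨h₃, h₄⟩ := hlink B hB C hC
        rw [(hpc _ hB C hC).2.1, ← h₃]
        refine hom_congr _ fun ν hν => ?_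
        have := (mem_pieceList (X := (B, sh'))).2 ⟨C, hC, ν, hν, rfl⟩
        rw [hB'] at this
        simp at this
      refine Derives.rule (G := pieceGrammar D w hw) (D.rule ρ sh' X)
        (Or.inl ⟨ρ, sh', X, hrule, rfl⟩) f' ?_ g' ?_
      · rintro _ ⟨B, hB, hBnil, rfl⟩
        refine hder _ hB (B, sh') rfl (fun C hC => (hlink B hB C hC).1) hBnil f' fun C hC ν => ?_
        exact congrFun (hlink B hB C hC).2 ν
      · have hgen : ∀ B ∈ pieceList X, g' B = (pieceRhs (D.piece ρ sh') B).eval f' := by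
          intro B hB
          obtain ⟨C, hC, ν, -, rfl⟩ := mem_pieceList.1 hB
          exact hg' C (hX ▸ hC) ν
        exact fun j => hgen _ (List.get_mem (pieceList X) j)

end PieceGrammar

end MCFTG

/-! ### Language and adjoining property of the piece grammar -/

namespace MCFTG

open RTree

variable {Γ : Type u} {rk : Γ → ℕ}

theorem Derives.exists_rule {G : MCFTG rk} {A : List G.N}
    {g : (C : G.N) → RTree rk (Fin (G.rkN C))} (h : G.Derives A g) :
    ∃ ρ ∈ G.rules, ρ.lhs = A ∧ ∃ f, (∀ B ∈ ρ.links, G.Derives B f) ∧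
      ∀ j, g (ρ.lhs.get j) = (ρ.rhs j).eval f := by
  cases h with
  | rule ρ hρ f hf _ hg => exact ⟨ρ, hρ, rfl, f, hf, hg⟩

theorem Derives.mem_terminals {G : MCFTG rk} {A : List G.N}
    {g : (C : G.N) → RTree rk (Fin (G.rkN C))} (h : G.Derives A g) :
    ∀ C ∈ A, ∀ a ∈ (g C).symbols, a ∈ G.terminals := by
  induction h with
  | rule ρ hρ f hf g hg ih =>
    intro C hC a ha
    obtain ⟨j, rfl⟩ := List.get_of_mem hC
    rw [hg j] at ha
    obtain ⟨s, hs, ha⟩ := mem_symbols_hom ha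
    rcases s with C | b
    · obtain ⟨B, hB, hCB⟩ := (G.links_cover ρ hρ C).1 (MCFTRule.mem_symbols.2 ⟨j, hs⟩)
      exact ih B hB C hCB a ha
    · have ha : a ∈ (init (rk := rk) b).symbols := ha
      rw [symbols_init, Multiset.mem_singleton] at ha
      exact ha ▸ G.rhs_terminals ρ hρ b (MCFTRule.mem_symbols.2 ⟨j, hs⟩)

theorem mem_terminals_of_mem_language [∀ n, Nonempty (RTree rk (Fin n))] {G : MCFTG rk}
    {t : RTree rk (Fin 0)} (ht : t ∈ G.language) {a : Γ} (ha : a ∈ t.symbols) :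
    a ∈ G.terminals := by
  obtain ⟨g, hg, hgt⟩ := mem_language_iff.1 ht
  refine hg.mem_terminals _ (List.mem_singleton_self _) a ?_
  rw [hgt, weaken, symbols_subst]
  exact Multiset.mem_add.2 (Or.inl ha)

section PieceGrammar

variable {G : MCFTG rk} {E : Type} {e : E → Γ} {D : G.Decompositions e}
  {w : RTree rk (Fin 1)} {hw : w.IsPattern}

theorem eval_startTree (X : G.ShapedBig e) (τ : E)
    (f : (B : Option (G.PieceNT e)) → RTree rk (Fin (G.pieceRank e B))) :
    (startTree w X τ).eval f =
      w.subst fun _ => RTree.weaken (f (some ⟨X, G.start, Sum.inr (none, τ)⟩)) := by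
  rw [startTree, eval_subst, eval_lift]
  refine subst_congr w fun x _ => ?_
  exact subst_congr _ fun i => i.elim0

theorem mem_language_pieceGrammar [Finite E] [∀ n, Nonempty (RTree rk (Fin n))] [Nonempty E]
    {t : RTree rk (Fin 0)} :
    t ∈ (pieceGrammar D w hw).language ↔ ∃ t' ∈ G.language, (w.subst fun _ => t') = t := by
  rw [mem_language_iff]
  constructor
  · rintro ⟨g, hg, hgt⟩
    obtain ⟨r, hr, hlhs, f, hf, hgf⟩ := hg.exists_rule
    rcases hr with ⟨ρ, sh, X, h, rfl⟩ | ⟨X, τ, h, rfl⟩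
    · have : none ∈ pieceList X := by
        rw [show pieceList X = [none] from hlhs]
        exact List.mem_singleton_self _
      exact absurd this none_notMem_pieceList
    · have hd := pieceGrammar_sound (hf _ rfl) X rfl
      rw [h.lhs_eq] at hd
      refine ⟨RTree.weaken (f (some ⟨X, G.start, Sum.inr (none, τ)⟩)),
        mem_language_iff.2 ⟨_, hd, ?_⟩, ?_⟩
      · simp only [h.shape_eq]
        refine (subst_congr _ fun i => ?_).trans (subst_weaken _ _).symm
        exact i.elim0
      · refine (eval_startTree X τ f).symm.trans ?_
        have h₀ : g none = eval f (startTree w X τ).weaken := hgf ⟨0, Nat.one_pos⟩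
        refine (congrArg (eval f) (weaken_self (startTree w X τ))).symm.trans ?_
        refine h₀.symm.trans (hgt.trans (weaken_self t))
  · rintro ⟨t, ht, rfl⟩
    obtain ⟨g, hg, hgt⟩ := mem_language_iff.1 ht
    obtain ⟨sh, pc, h₁, h₂⟩ := pieceGrammar_complete (D := D) (w := w) (hw := hw) hg
    obtain ⟨-, hS, hroot, hτ⟩ := h₁ G.start (List.mem_singleton_self _)
    obtain ⟨τ, hτ⟩ := hτ G.rk_start
    let X : G.ShapedBig e := (⟨[G.start], G.start_mem⟩, sh)
    let ν : PieceName (fun i => rk (e i)) (G.rkN G.start) := Sum.inr (none, τ)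
    -- The rank of the initial nonterminal is 0 only up to a propositional equality, so closed trees
    -- are compared after substituting dummies for the nonexistent variables.
    have hpc : (pc G.start ν).weaken = t := by
      have h : ((sh G.start).1.hom (pc G.start)).subst (fun _ => Classical.arbitrary _) =
          (t.weaken : RTree rk (Fin (G.rkN G.start))).subst
            fun _ => (Classical.arbitrary (RTree rk (Fin 0))) := by
        rw [← hS, hgt]
      rw [subst_weaken, weaken_self, hτ] at h
      rw [← h]
      refine Eq.trans ?_ (subst_subst (pc G.start ν) _ _).symm
      exact subst_congr _ fun i => i.elim0
    have hX : IsStartRule X τ := by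
      refine ⟨rfl, hτ, t, ht, ?_⟩
      rw [← hpc]
      refine rootLabel_subst (hroot ν ?_) _
      rw [hτ]
      exact mem_symbols_node.2 (Or.inl rfl)
    let g' : (B : Option (G.PieceNT e)) → RTree rk (Fin (G.pieceRank e B)) := fun B => match B with
      | none => w.subst fun _ => t
      | some B => pc B.2.1 B.2.2
    refine ⟨g', Derives.rule (G := pieceGrammar D w hw) (startRule w X τ)
      (Or.inr ⟨X, τ, hX, rfl⟩) g' ?_ g' ?_, (weaken_self _).symm⟩
    · rintro B rfl
      exact h₂ X rfl (fun _ _ => rfl) (by simp [hX.pieceList_eq]) g' fun _ _ _ => rfl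
    · have hgen : ∀ B ∈ [none], g' B = RTree.eval g' (startTree w X τ).weaken := by
        intro B hB
        obtain rfl := List.mem_singleton.1 hB
        refine Eq.trans ?_ (congrArg (RTree.eval g') (weaken_self (startTree w X τ))).symm
        rw [eval_startTree]
        exact congrArg (fun t => w.subst fun _ => t) hpc.symm
      exact fun j => hgen _ (List.get_mem [none] j)

/-- The class of a symbol with respect to the equivalence that identifies the elements of `R`. -/
noncomputable def classOf (R : Set Γ) (a : Γ) : Option Γ :=
  open Classical in if a ∈ R then none else some a

/-- The class of a symbol of the piece grammar. -/
noncomputable def pieceClass (G : MCFTG rk) (e : E → Γ) (R : Set Γ) :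
    Option (G.PieceNT e) ⊕ Γ → Option Γ
  | Sum.inl none => none
  | Sum.inl (some B) => classOf R (e B.2.2.label)
  | Sum.inr a => classOf R a

theorem pieceClass_eq {R : Set Γ} {b : Option (G.PieceNT e) ⊕ Γ} {σ : E} (h : HasLabel e b σ) :
    pieceClass G e R b = classOf R (e σ) := by
  rcases b with (_ | B) | a
  · exact h.elim
  · rw [← show B.2.2.label = σ from h]
    rfl
  · rw [show a = e σ from h]
    rfl

/-- Pieces have equal root and foot labels, so their rules respect equality of labels. Only the
initial nonterminal may begin with several labels, and these are identified; root consistency says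
precisely that this is allowed. -/
theorem isMCTAG_pieceGrammar [Finite E] [∀ n, Nonempty (RTree rk (Fin n))] [Nonempty E]
    (he : ∀ σ, e σ ∈ G.terminals) (hne : G.language.Nonempty)
    (hRC : RootConsistent ((fun t => w.subst fun _ => t) '' G.language)) :
    (pieceGrammar D w hw).IsMCTAG := by
  -- The labels to be identified: all possible roots of the trees `w[t]`.
  let R : Set Γ := {a | ∃ t ∈ G.language, (w.subst fun _ => t).rootLabel = some a}
  constructor
  · rintro r (⟨ρ, sh, X, h, rfl⟩ | ⟨X, τ, h, rfl⟩)
    · have hgen : ∀ B ∈ pieceList X, (pieceRhs (D.piece ρ sh) B).IsFooted := by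
        intro B hB
        obtain ⟨C, hC, ν, hν, rfl⟩ := mem_pieceList.1 hB
        obtain ⟨j, rfl, hd⟩ := h.isDecomposition (h.lhs_eq ▸ hC)
        rcases Nat.eq_zero_or_pos ν.rank with h₀ | h₀
        · exact Or.inl h₀
        · obtain ⟨b, hb, -⟩ := (hd.footLabel ν hν).resolve_left h₀.ne'
          exact Or.inr ⟨h₀, b, hb⟩
      exact fun j => hgen _ (List.get_mem (pieceList X) j)
    · have hgen : ∀ B ∈ [none], G.pieceRank e B = 0 := by
        intro B hB
        obtain rfl := List.mem_singleton.1 hB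
        rfl
      exact fun j => Or.inl (hgen _ (List.get_mem [none] j))
  · refine ⟨Setoid.ker (pieceClass G e R), ?_, ?_, ?_⟩
    · intro s _ t _ hst h
      have h : classOf R s = classOf R t := h
      by_cases hs : s ∈ R <;> by_cases ht : t ∈ R
      · obtain ⟨t₁, ht₁, hs⟩ := hs
        obtain ⟨t₂, ht₂, ht⟩ := ht
        exact hRC _ ⟨t₁, ht₁, rfl⟩ _ ⟨t₂, ht₂, rfl⟩ s t hs ht hst
      all_goals simp_all [classOf]
    · rintro (_ | B)
      · obtain ⟨t, ht⟩ := hne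
        cases hwt : w.subst (fun _ => t) with
        | var x => exact x.elim0
        | node a c =>
          have hmem : a ∈ (w.subst fun _ => t).symbols := by
            rw [hwt]
            exact mem_symbols_node.2 (Or.inl rfl)
          refine ⟨a, ?_, ?_⟩
          · rw [symbols_subst, Multiset.mem_add, Multiset.mem_bind] at hmem
            rcases hmem with h | ⟨-, -, h⟩
            · exact Or.inr h
            · exact Or.inl (mem_terminals_of_mem_language ht h)
          · have : a ∈ R := ⟨t, ht, by rw [hwt]; rfl⟩
            change none = classOf R a
            simp [classOf, this]
      · exact ⟨e B.2.2.label, Or.inl (he _), rfl⟩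
    · rintro r (⟨ρ, sh, X, h, rfl⟩ | ⟨X, τ, h, rfl⟩)
      · have hgen : ∀ B ∈ pieceList X,
            (∃ a, (pieceRhs (D.piece ρ sh) B).rootLabel = some a ∧
              pieceClass G e R a = pieceClass G e R (Sum.inl B)) ∧
            (1 ≤ G.pieceRank e B → ∀ a, (pieceRhs (D.piece ρ sh) B).HasFootLabel a →
              pieceClass G e R a = pieceClass G e R (Sum.inl B)) := by
          intro B hB
          obtain ⟨C, hC, ν, hν, rfl⟩ := mem_pieceList.1 hB
          obtain ⟨j, rfl, hd⟩ := h.isDecomposition (h.lhs_eq ▸ hC)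
          obtain ⟨b, hb, hbν⟩ := hd.rootLabel ν hν
          refine ⟨⟨b, hb, pieceClass_eq hbν⟩, fun hk a ha => ?_⟩
          have h₀ : 0 < ν.rank := hk
          obtain ⟨b', hb', hbν'⟩ := (hd.footLabel ν hν).resolve_left h₀.ne'
          rw [ha.unique h₀ (hd.isPattern_piece ν hν).1 hb']
          exact pieceClass_eq hbν'
        exact fun j => hgen _ (List.get_mem (pieceList X) j)
      · have hgen : ∀ B ∈ [none],
            (∃ a, (RTree.weaken (V := Fin (G.pieceRank e B)) (startTree w X τ)).rootLabel = some a ∧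
              pieceClass G e R a = pieceClass G e R (Sum.inl B)) ∧
            (1 ≤ G.pieceRank e B → ∀ a,
              (RTree.weaken (V := Fin (G.pieceRank e B)) (startTree w X τ)).HasFootLabel a →
              pieceClass G e R a = pieceClass G e R (Sum.inl B)) := by
          intro B hB
          obtain rfl := List.mem_singleton.1 hB
          refine ⟨?_, fun h => absurd h (by simp [pieceRank])⟩
          obtain ⟨t, ht, hroot⟩ := h.rootLabel
          -- If `w` is the variable, the root is the nonterminal for the piece, and the condition on
          -- initial rules puts its label into `R`. Otherwise the root is that of `w`.
          cases w with
          | var x =>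
            refine ⟨_, rfl, ?_⟩
            have : e τ ∈ R := ⟨t, ht, hroot⟩
            change classOf R (e τ) = none
            simp [classOf, this]
          | node a c =>
            refine ⟨Sum.inr a, rfl, ?_⟩
            have : a ∈ R := ⟨t, ht, rfl⟩
            change classOf R a = none
            simp [classOf, this]
        exact fun j => hgen _ (List.get_mem [none] j)

end PieceGrammar

end MCFTG

/-! ### Linear nondeleting tree homomorphisms -/

namespace RTree

variable {Γ : Type u} {rk : Γ → ℕ} {V : Type v} {N : Type} {rkN : N → ℕ}

theorem nonempty_of_closed (t : RTree rk (Fin 0)) (n : ℕ) : Nonempty (RTree rk (Fin n)) :=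
  ⟨t.weaken⟩

theorem rootLabel_weaken (t : RTree rk (Fin 0)) : (t.weaken : RTree rk V).rootLabel =
    t.rootLabel := by
  cases t with
  | var x => exact x.elim0
  | node s c => rfl

theorem hom_weaken (t : RTree rk (Fin 0)) (h : (a : Γ) → RTree rk (Fin (rk a))) :
    (t.weaken : RTree rk V).hom h = (t.hom h).weaken :=
  (hom_subst t _ h).trans (subst_congr _ fun i => i.elim0)

/-- The tree homomorphism on `N ∪ Γ` that leaves the symbols of `N` unchanged. -/
def homRight (rkN : N → ℕ) (h : (a : Γ) → RTree rk (Fin (rk a))) :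
    RTree (Sum.elim rkN rk) V → RTree (Sum.elim rkN rk) V :=
  hom fun s => match s with
    | Sum.inl C => init (rk := Sum.elim rkN rk) (Sum.inl C)
    | Sum.inr a => (h a).lift rkN

variable {h : (a : Γ) → RTree rk (Fin (rk a))}

theorem eval_homRight (f : (C : N) → RTree rk (Fin (rkN C))) (t : RTree (Sum.elim rkN rk) V) :
    (t.homRight rkN h).eval (fun C => (f C).hom h) = (t.eval f).hom h := by
  refine (hom_hom t _ _).trans ((hom_congr t fun s _ => ?_).trans (hom_hom t _ _).symm)
  rcases s with C | a
  · exact init_hom (rk := Sum.elim rkN rk) (Sum.inl C) _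
  · exact (eval_lift _ _).trans (init_hom a h).symm

theorem isPattern_homRight_symbol (hh : ∀ a, (h a).IsPattern) (s : N ⊕ Γ) :
    (match s with
      | Sum.inl C => init (rk := Sum.elim rkN rk) (Sum.inl C)
      | Sum.inr a => (h a).lift rkN : RTree (Sum.elim rkN rk) (Fin (Sum.elim rkN rk s))).IsPattern
    := by
  rcases s with C | a
  · exact isPattern_init (rk := Sum.elim rkN rk) (Sum.inl C)
  · exact isPattern_iff.2 ((vars_lift _).trans (isPattern_iff.1 (hh a)))

/-- The symbols that result from a symbol by a tree homomorphism on `Γ`. -/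
def homRightSymbols (h : (a : Γ) → RTree rk (Fin (rk a))) : N ⊕ Γ → Multiset (N ⊕ Γ)
  | Sum.inl C => {Sum.inl C}
  | Sum.inr a => (h a).symbols.map Sum.inr

theorem symbols_homRight (hh : ∀ a, (h a).IsPattern) (t : RTree (Sum.elim rkN rk) V) :
    (t.homRight rkN h).symbols = t.symbols.bind (homRightSymbols h) := by
  refine (symbols_hom t _ fun s _ => isPattern_homRight_symbol hh s).trans
    (Multiset.bind_congr fun s _ => ?_)
  rcases s with C | a
  · exact symbols_init (rk := Sum.elim rkN rk) (Sum.inl C)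
  · exact symbols_lift _

end RTree

open RTree in
/-- The application of a tree homomorphism on `Γ` to the right-hand side of a rule. -/
def MCFTRule.map {N : Type} {Γ : Type u} {rkN : N → ℕ} {rk : Γ → ℕ}
    (h : (a : Γ) → RTree rk (Fin (rk a))) (ρ : MCFTRule rkN rk) : MCFTRule rkN rk :=
  ⟨ρ.lhs, fun j => (ρ.rhs j).homRight rkN h, ρ.links⟩

namespace MCFTRule

open RTree

variable {N : Type} {Γ : Type u} {rkN : N → ℕ} {rk : Γ → ℕ}
  {h : (a : Γ) → RTree rk (Fin (rk a))}

theorem symbols_map (hh : ∀ a, (h a).IsPattern) (ρ : MCFTRule rkN rk) :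
    (ρ.map h).symbols = ρ.symbols.bind (homRightSymbols h) := by
  simp only [symbols, Multiset.finset_sum_bind]
  exact Finset.sum_congr rfl fun j _ => symbols_homRight hh (ρ.rhs j)

theorem inl_mem_symbols_map (hh : ∀ a, (h a).IsPattern) (ρ : MCFTRule rkN rk) {C : N} :
    Sum.inl C ∈ (ρ.map h).symbols ↔ Sum.inl C ∈ ρ.symbols := by
  rw [symbols_map hh, Multiset.mem_bind]
  constructor
  · rintro ⟨C' | a, hs, hC⟩
    · rwa [Multiset.mem_singleton.1 hC]
    · simp [homRightSymbols] at hC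
  · exact fun hC => ⟨_, hC, Multiset.mem_singleton_self _⟩

theorem inr_mem_symbols_map (hh : ∀ a, (h a).IsPattern) (ρ : MCFTRule rkN rk) {b : Γ}
    (hb : Sum.inr b ∈ (ρ.map h).symbols) :
    ∃ a, Sum.inr a ∈ ρ.symbols ∧ b ∈ (h a).symbols := by
  rw [symbols_map hh, Multiset.mem_bind] at hb
  obtain ⟨C | a, hs, hb⟩ := hb
  · simp [homRightSymbols] at hb
  · exact ⟨a, hs, by simpa [homRightSymbols] using hb⟩

theorem left_symbols_map (hh : ∀ a, (h a).IsPattern) (ρ : MCFTRule rkN rk) :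
    (ρ.map h).symbols.filterMap Sum.getLeft? =
    ρ.symbols.filterMap Sum.getLeft? := by
  rw [symbols_map hh]
  induction ρ.symbols using Multiset.induction_on with
  | empty => rfl
  | cons s m ih =>
    rw [Multiset.cons_bind, Multiset.filterMap_add, ih, ← Multiset.singleton_add s m,
      Multiset.filterMap_add]
    congr 1
    rcases s with C | a
    · rfl
    · refine Eq.trans (Multiset.eq_zero_of_forall_notMem fun C hC => ?_) rfl
      simp [homRightSymbols, Multiset.mem_filterMap] at hC

end MCFTRule

namespace MCFTG

open RTree

variable {Γ : Type u} {rk : Γ → ℕ}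

/-- The image of a grammar under a linear and nondeleting tree homomorphism. -/
def map (G : MCFTG rk) (h : (a : Γ) → RTree rk (Fin (rk a))) (hh : ∀ a, (h a).IsPattern) :
    MCFTG rk where
  N := G.N
  finite_N := G.finite_N
  rkN := G.rkN
  big := G.big
  finite_big := G.finite_big
  big_ne_nil := G.big_ne_nil
  big_nodup := G.big_nodup
  big_inj := G.big_inj
  terminals := G.terminals ∪ ⋃ a ∈ G.terminals, {b | b ∈ (h a).symbols}
  finite_terminals := by
    classical
    refine G.finite_terminals.union (G.finite_terminals.biUnion fun a _ => ?_)
    refine (h a).symbols.toFinset.finite_toSet.subset fun b hb => ?_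
    simpa using hb
  exists_terminal := G.exists_terminal.imp fun _ h => ⟨Or.inl h.1, h.2⟩
  start := G.start
  start_mem := G.start_mem
  rk_start := G.rk_start
  rules := MCFTRule.map h '' G.rules
  finite_rules := G.finite_rules.image _
  lhs_mem := by
    rintro _ ⟨ρ, hρ, rfl⟩
    exact G.lhs_mem ρ hρ
  rhs_pattern := by
    rintro _ ⟨ρ, hρ, rfl⟩ j
    exact (G.rhs_pattern ρ hρ j).hom fun s _ => isPattern_homRight_symbol hh s
  rhs_terminals := by
    rintro _ ⟨ρ, hρ, rfl⟩ b hb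
    obtain ⟨a, ha, hb⟩ := ρ.inr_mem_symbols_map hh hb
    exact Or.inr (Set.mem_biUnion (G.rhs_terminals ρ hρ a ha) hb)
  rhs_unique := by
    rintro _ ⟨ρ, hρ, rfl⟩
    rw [ρ.left_symbols_map hh]
    exact G.rhs_unique ρ hρ
  links_big := by
    rintro _ ⟨ρ, hρ, rfl⟩
    exact G.links_big ρ hρ
  links_cover := by
    rintro _ ⟨ρ, hρ, rfl⟩ C
    rw [ρ.inl_mem_symbols_map hh]
    exact G.links_cover ρ hρ C
  links_disjoint := by
    rintro _ ⟨ρ, hρ, rfl⟩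
    exact G.links_disjoint ρ hρ

variable {G : MCFTG rk} {h : (a : Γ) → RTree rk (Fin (rk a))} {hh : ∀ a, (h a).IsPattern}

theorem Derives.map {A : List G.N} {g : (C : G.N) → RTree rk (Fin (G.rkN C))}
    (hg : G.Derives A g) : (G.map h hh).Derives A fun C => (g C).hom h := by
  induction hg with
  | rule ρ hρ f hf g hg ih =>
    refine Derives.rule (G := G.map h hh) (ρ.map h) ⟨ρ, hρ, rfl⟩ (fun C => (f C).hom h) ih _
      fun j => ?_
    refine (congrArg (RTree.hom h) (hg j)).trans (eval_homRight _ _).symm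

/-- The rules correspond one to one in their links, so a derivation of the image grammar is lifted
link by link and the preimages are glued along the disjoint links. -/
theorem exists_derives_of_map [∀ n, Nonempty (RTree rk (Fin n))] {A : List (G.map h hh).N}
    {g' : (C : (G.map h hh).N) → RTree rk (Fin ((G.map h hh).rkN C))}
    (hg : (G.map h hh).Derives A g') :
    ∃ g : (C : G.N) → RTree rk (Fin (G.rkN C)), G.Derives A g ∧ ∀ C ∈ A, g' C = (g C).hom h := by
  classical
  induction hg with
  | rule r hr f' hf' g' hg' ih =>
    obtain ⟨ρ, hρ, rfl⟩ := hr
    choose fB hfB hfBh using ih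
    let ρ' : G.rules := ⟨ρ, hρ⟩
    let f : (C : G.N) → RTree rk (Fin (G.rkN C)) := fun C =>
      if h : (G.link ρ' C).1 ∈ ρ.links then fB _ h C else Classical.arbitrary _
    have hf : ∀ (B : List G.N) (hB : B ∈ ρ.links), ∀ C ∈ B, f C = fB B hB C := by
      intro B hB C hC
      have := link_eq (ρ := ρ') (B := ⟨B, G.links_big ρ hρ hB⟩) hB hC
      have h' : (G.link ρ' C).1 ∈ ρ.links := this ▸ hB
      simp only [f, dif_pos h']
      obtain rfl : (G.link ρ' C).1 = B := congrArg Subtype.val this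
      rfl
    obtain ⟨g, hg⟩ := Function.Injective.exists_dep_extend
      (P := fun C => RTree rk (Fin (G.rkN C)))
      (List.nodup_iff_injective_get.1 (G.big_nodup _ (G.lhs_mem ρ hρ)))
      fun j => (ρ.rhs j).eval f
    refine ⟨g, .rule ρ hρ f (fun B hB => (hfB B hB).congr fun C hC => (hf B hB C hC).symm) g hg,
      fun C hC => ?_⟩
    obtain ⟨j, rfl⟩ := List.get_of_mem (show C ∈ ρ.lhs from hC)
    refine (hg' j).trans (Eq.trans (eval_congr fun C hC => ?_)
      ((eval_homRight f (ρ.rhs j)).trans (congrArg (RTree.hom h) (hg j).symm)))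
    obtain ⟨B, hB, hCB⟩ := (G.links_cover ρ hρ C).1
      ((ρ.inl_mem_symbols_map hh).1 (MCFTRule.mem_symbols.2 ⟨j, hC⟩))
    rw [hf B hB C hCB]
    exact hfBh B hB C hCB

theorem language_map [∀ n, Nonempty (RTree rk (Fin n))] :
    (G.map h hh).language = RTree.hom h '' G.language := by
  -- Substituting any closed tree for the variables undoes `weaken`.
  have hinj {n : ℕ} {t t' : RTree rk (Fin 0)} (he : (t.weaken : RTree rk (Fin n)) = t'.weaken) :
      t = t' := by
    have := congrArg (fun s => RTree.subst (fun _ => Classical.arbitrary (RTree rk (Fin 0))) s) he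
    simpa only [subst_weaken, weaken_self] using this
  ext t
  rw [mem_language_iff]
  constructor
  · rintro ⟨g', hg', ht⟩
    obtain ⟨g, hg, hgg⟩ := exists_derives_of_map hg'
    have hcl : ∀ n, n = 0 → ∀ t : RTree rk (Fin n), ∃ t₀ : RTree rk (Fin 0), t₀.weaken = t := by
      rintro _ rfl t
      exact ⟨t, weaken_self t⟩
    obtain ⟨t₀, ht₀⟩ := hcl _ G.rk_start (g G.start)
    refine ⟨t₀, mem_language_iff.2 ⟨g, hg, ht₀.symm⟩, hinj (n := G.rkN G.start) ?_⟩
    rw [← hom_weaken, ht₀]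
    exact (hgg G.start (List.mem_singleton_self _)).symm.trans ht
  · rintro ⟨t, ht, rfl⟩
    obtain ⟨g, hg, hgt⟩ := mem_language_iff.1 ht
    refine ⟨_, hg.map, ?_⟩
    exact (congrArg (RTree.hom h) hgt).trans (hom_weaken t h)

/-! ### Finite languages -/

section FiniteLanguage

/-- A grammar that generates a finite tree language. -/
def ofFinite (s : Γ) (hs : 1 ≤ rk s) (L : Set (RTree rk (Fin 0))) (hL : L.Finite) : MCFTG rk where
  N := Unit
  finite_N := inferInstance
  rkN _ := 0
  big := {[()]}
  finite_big := Set.finite_singleton _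
  big_ne_nil := by simp
  big_nodup := by simp
  big_inj := by simp
  terminals := {s} ∪ ⋃ t ∈ L, {a | a ∈ t.symbols}
  finite_terminals := by
    classical
    refine (Set.finite_singleton s).union (hL.biUnion fun t _ => ?_)
    refine t.symbols.toFinset.finite_toSet.subset fun b hb => ?_
    simpa using hb
  exists_terminal := ⟨s, Or.inl rfl, hs⟩
  start := ()
  start_mem := rfl
  rk_start := rfl
  rules := (fun t => .ofFun [()] (fun _ => t.lift _) ∅) '' L
  finite_rules := hL.image _
  lhs_mem := by
    rintro _ ⟨t, -, rfl⟩
    rfl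
  rhs_pattern := by
    rintro _ ⟨t, -, rfl⟩ j
    exact isPattern_closed _
  rhs_terminals := by
    rintro _ ⟨t, ht, rfl⟩ a ha
    obtain ⟨_, -, ha⟩ := MCFTRule.mem_symbols_ofFun.1 ha
    rw [symbols_lift] at ha
    exact Or.inr (Set.mem_biUnion ht (by simpa using ha))
  rhs_unique := by
    rintro _ ⟨t, -, rfl⟩
    rw [Multiset.eq_zero_of_forall_notMem (s := Multiset.filterMap _ _)]
    · exact Multiset.nodup_zero
    · intro C hC
      obtain ⟨b, hb, hbC⟩ := (Multiset.mem_filterMap _ _).1 hC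
      obtain ⟨_, -, hb⟩ := MCFTRule.mem_symbols_ofFun.1 hb
      rw [symbols_lift] at hb
      obtain ⟨a, -, rfl⟩ := Multiset.mem_map.1 hb
      simp at hbC
  links_big := by
    rintro _ ⟨t, -, rfl⟩
    exact Set.empty_subset _
  links_cover := by
    rintro _ ⟨t, -, rfl⟩ C
    rw [MCFTRule.mem_symbols_ofFun]
    simp [symbols_lift, MCFTRule.ofFun]
  links_disjoint := by
    rintro _ ⟨t, -, rfl⟩ B hB
    exact hB.elim

theorem language_ofFinite {s : Γ} {hs : 1 ≤ rk s} {L : Set (RTree rk (Fin 0))} {hL : L.Finite} :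
    (ofFinite s hs L hL).language = L := by
  ext t
  have := nonempty_of_closed t
  rw [mem_language_iff]
  constructor
  · rintro ⟨g, hg, hgt⟩
    obtain ⟨_, ⟨t', ht', rfl⟩, -, f, -, hgf⟩ := hg.exists_rule
    have h : g () = RTree.eval f (t'.lift _) := hgf ⟨0, Nat.one_pos⟩
    rw [eval_lift] at h
    have : t = t' := (weaken_self t).symm.trans (hgt.symm.trans h)
    exact this ▸ ht'
  · intro ht
    refine ⟨fun _ => t, Derives.rule (G := ofFinite s hs L hL) _ ⟨t, ht, rfl⟩ (fun _ => t)
      (fun B hB => hB.elim) _ fun j => ?_, (weaken_self t).symm⟩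
    exact (eval_lift _ t).symm

/-- With no rules and a single terminal, the total relation meets all conditions. The empty language
is treated separately because without a closed tree the required default trees may not exist. -/
theorem empty_mem_MCTAL {s : Γ} (hs : 1 ≤ rk s) : (∅ : Set (RTree rk (Fin 0))) ∈ MCTAL rk := by
  refine ⟨ofFinite s hs ∅ Set.finite_empty, ⟨?_, ⊤, ?_, ?_, ?_⟩, language_ofFinite⟩
  · rintro _ ⟨t, ht, -⟩
    exact ht.elim
  · rintro a ha b hb hab
    simp only [ofFinite, Set.mem_empty_iff_false, Set.iUnion_of_empty, Set.iUnion_empty,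
      Set.union_empty, Set.mem_singleton_iff] at ha hb
    exact absurd (ha.trans hb.symm) hab
  · exact fun C => ⟨s, Or.inl rfl, trivial⟩
  · rintro _ ⟨t, ht, -⟩
    exact ht.elim

end FiniteLanguage

/-! ### Root consistency and the three statements -/

/-- If the root of a right-hand side is a terminal, it is the root label; if it is a nonterminal,
the tree substituted for it supplies the root label, and transitivity applies. -/
theorem Derives.exists_rootLabel {r : Setoid (G.N ⊕ Γ)} (hr : ∀ ρ ∈ G.rules,
    ∀ j : Fin ρ.lhs.length, ∃ a, (ρ.rhs j).rootLabel = some a ∧ r a (Sum.inl (ρ.lhs.get j)))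
    {A : List G.N} {g : (C : G.N) → RTree rk (Fin (G.rkN C))} (hg : G.Derives A g) :
    ∀ C ∈ A, ∃ a ∈ G.terminals, (g C).rootLabel = some a ∧ r (Sum.inr a) (Sum.inl C) := by
  induction hg with
  | rule ρ hρ f hf g hg ih =>
    intro C hC
    obtain ⟨j, rfl⟩ := List.get_of_mem hC
    obtain ⟨b, hb, hbC⟩ := hr ρ hρ j
    have hmem := MCFTRule.mem_symbols.2 ⟨j, mem_symbols_of_rootLabel hb⟩
    rw [hg j]
    cases hu : ρ.rhs j with
    | var x => simp [hu, rootLabel] at hb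
    | node s c =>
      obtain rfl : s = b := by simpa [hu, rootLabel] using hb
      rcases s with B | a
      · obtain ⟨X, hX, hBX⟩ := (G.links_cover ρ hρ B).1 hmem
        obtain ⟨a, ha, haB, har⟩ := ih X hX B hBX
        exact ⟨a, ha, rootLabel_subst haB _, r.trans har hbC⟩
      · exact ⟨a, G.rhs_terminals ρ hρ a hmem, rfl, hbC⟩

theorem IsMCTAG.rootConsistent (hG : G.IsMCTAG) : RootConsistent G.language := by
  intro t₁ ht₁ t₂ ht₂ s₁ s₂ hs₁ hs₂ hne
  have := nonempty_of_closed t₁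
  obtain ⟨-, r, hr₁, -, hr₃⟩ := hG
  have key : ∀ t ∈ G.language, ∀ s, t.rootLabel = some s →
      s ∈ G.terminals ∧ r (Sum.inr s) (Sum.inl G.start) := by
    intro t ht s hs
    obtain ⟨g, hg, hgt⟩ := mem_language_iff.1 ht
    obtain ⟨a, ha, hroot, har⟩ := hg.exists_rootLabel (fun ρ hρ j => (hr₃ ρ hρ j).1) G.start
      (List.mem_singleton_self _)
    rw [hgt, rootLabel_weaken, hs, Option.some.injEq] at hroot
    exact hroot ▸ ⟨ha, har⟩
  obtain ⟨h₁, h₁'⟩ := key t₁ ht₁ s₁ hs₁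
  obtain ⟨h₂, h₂'⟩ := key t₂ ht₂ s₂ hs₂
  exact hr₁ s₁ h₁ s₂ h₂ hne (r.trans h₁' (r.symm h₂'))

/-- The common source of (1) and of the forward direction of (2), for `w = x₁` and `w = #(x₁)`. -/
theorem image_subst_mem_MCTAL (G : MCFTG rk) {w : RTree rk (Fin 1)} (hw : w.IsPattern)
    (hRC : RootConsistent ((fun t => w.subst fun _ => t) '' G.language)) :
    (fun t => w.subst fun _ => t) '' G.language ∈ MCTAL rk := by
  obtain ⟨s, hs, hrk⟩ := G.exists_terminal
  rcases G.language.eq_empty_or_nonempty with h | hne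
  · rw [h, Set.image_empty]
    exact empty_mem_MCTAL hrk
  · have := nonempty_of_closed hne.some
    have := G.finite_terminals.to_subtype
    obtain ⟨n, ⟨φ⟩⟩ := Finite.exists_equiv_fin G.terminals
    have : Nonempty (Fin n) := ⟨φ ⟨s, hs⟩⟩
    -- Labels are indices of terminals rather than terminals, since nonterminals live in `Type`
    -- while `Γ` may lie in a higher universe.
    let e : Fin n → Γ := fun i => (φ.symm i).1
    obtain ⟨D⟩ := G.nonempty_decompositions e fun a ha => ⟨φ ⟨a, ha⟩, by simp [e]⟩
    refine ⟨pieceGrammar D w hw, isMCTAG_pieceGrammar (fun i => (φ.symm i).2) hne hRC, ?_⟩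
    ext t
    exact mem_language_pieceGrammar

end MCFTG

theorem MCTAL_subset_MCFT {Γ : Type u} (rk : Γ → ℕ) : MCTAL rk ⊆ MCFT rk :=
  fun _ ⟨G, _, hG⟩ => ⟨G, hG⟩

theorem MCTAL_eq {Γ : Type u} (rk : Γ → ℕ) :
    MCTAL rk = {L | L ∈ MCFT rk ∧ RootConsistent L} := by
  ext L
  constructor
  · rintro ⟨G, hG, rfl⟩
    exact ⟨⟨G, rfl⟩, hG.rootConsistent⟩
  · rintro ⟨⟨G, rfl⟩, hRC⟩
    have hw : (RTree.var 0 : RTree rk (Fin 1)).IsPattern :=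
      ⟨Multiset.nodup_singleton _, fun x => Multiset.mem_singleton.2 (Subsingleton.elim _ _)⟩
    have himg : (fun t => (RTree.var 0 : RTree rk (Fin 1)).subst fun _ => t) '' G.language =
        G.language := Set.image_id _
    have := G.image_subst_mem_MCTAL hw (himg.symm ▸ hRC)
    rwa [himg] at this

theorem mark_image_mem_MCTAL_iff {Γ : Type u} {rk : Γ → ℕ} {s : Γ} (hs : rk s = 1)
    {L : Set (RTree rk (Fin 0))} (hL : ∀ t ∈ L, s ∉ t.symbols) :
    L ∈ MCFT rk ↔ RTree.mark s '' L ∈ MCTAL rk := by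
  classical
  constructor
  · rintro ⟨G, rfl⟩
    have hw : (RTree.mark s (.var 0) : RTree rk (Fin 1)).IsPattern := by
      rw [RTree.isPattern_iff]
      simp [RTree.mark, RTree.vars, hs]
    refine G.image_subst_mem_MCTAL hw ?_
    rintro _ ⟨t₁, -, rfl⟩ _ ⟨t₂, -, rfl⟩ s₁ s₂ h₁ h₂ hne
    exact absurd (Option.some_injective _ (h₁.symm.trans h₂)) hne
  · rintro ⟨G, -, hG⟩
    rcases L.eq_empty_or_nonempty with rfl | ⟨t₀, -⟩
    · obtain ⟨a, -, ha⟩ := G.exists_terminal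
      exact MCTAL_subset_MCFT rk (MCFTG.empty_mem_MCTAL ha)
    have := RTree.nonempty_of_closed t₀
    -- The homomorphism that erases `s`, sending it to `x₁`, and fixes all other symbols. It maps
    -- `s(t)` to `t`, as `s` does not occur in `t`.
    let h : (a : Γ) → RTree rk (Fin (rk a)) := fun a =>
      if ha : a = s then .var ⟨0, by rw [ha, hs]; exact one_pos⟩ else RTree.init a
    have hh : ∀ a, (h a).IsPattern := by
      intro a
      by_cases ha : a = s
      · subst ha
        simp only [h, dif_pos]
        refine ⟨Multiset.nodup_singleton _, fun x => Multiset.mem_singleton.2 ?_⟩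
        ext
        have := x.2
        simp only
        omega
      · simp only [h, dif_neg ha]
        exact RTree.isPattern_init a
    refine ⟨G.map h hh, ?_⟩
    rw [MCFTG.language_map, hG, Set.image_image]
    refine (Set.image_congr fun t ht => ?_).trans (Set.image_id L)
    have h₁ : (RTree.mark s t).hom h = t.hom h := by
      simp only [RTree.mark, RTree.hom, h, dif_pos, RTree.subst]
    rw [h₁, id, ← RTree.hom_init t]
    conv_lhs => rw [RTree.hom_init t]
    refine RTree.hom_congr t fun a ha => ?_
    exact dif_neg fun (h' : a = s) => hL t ht (h' ▸ ha)

theorem exists_mem_MCFT_not_rootConsistent {Γ : Type u} {rk : Γ → ℕ} {a p q s : Γ} (hs : 1 ≤ rk s)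
    (ha : rk a = 0) (hpq : p ≠ q) (hrk : rk p = rk q) :
    ∃ L ∈ MCFT rk, ¬ RootConsistent L := by
  let t₀ : RTree rk (Fin 0) := .node a fun i => (Fin.cast ha i).elim0
  let t (b : Γ) : RTree rk (Fin 0) := .node b fun _ => t₀
  refine ⟨{t p, t q}, ⟨MCFTG.ofFinite s hs _ (Set.toFinite _), MCFTG.language_ofFinite⟩,
    fun h => ?_⟩
  exact h (t p) (Or.inl rfl) (t q) (Or.inr rfl) p q rfl rfl hpq hrk

theorem mainTheorem5 {Γ : Type u} (rk : Γ → ℕ) :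
    MCTAL rk = {L | L ∈ MCFT rk ∧ RootConsistent L} ∧
    (∀ hash : Γ, rk hash = 1 →
      ∀ L : Set (RTree rk (Fin 0)), (∀ t ∈ L, hash ∉ t.symbols) →
        (L ∈ MCFT rk ↔ RTree.mark hash '' L ∈ MCTAL rk)) ∧
    ((∃ s, 1 ≤ rk s) → (∃ a, rk a = 0) → (∃ s t, s ≠ t ∧ rk s = rk t) →
      MCTAL rk ⊂ MCFT rk) := by
  refine ⟨MCTAL_eq rk, fun hash hrk L hL => mark_image_mem_MCTAL_iff hrk hL, ?_⟩
  rintro ⟨s, hs⟩ ⟨a, ha⟩ ⟨p, q, hpq, hrk⟩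
  refine ⟨MCTAL_subset_MCFT rk, fun h => ?_⟩
  obtain ⟨L, hL, hRC⟩ := exists_mem_MCFT_not_rootConsistent hs ha hpq hrk
  exact hRC ((MCTAL_eq rk).subset (h hL)).2
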